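/- **Proposition ($p$-Bochner formula).** Let $(M,\langle\cdot,\cdot\rangle)$ be a smooth finite-dimensional Riemannian manifold, possibly with boundary, and let $p>1$. For a function $u$ write $\nabla u$ for its gradient, $H_u$ for its Hessian, $H_u(v,w)=\langle\nabla_v\nabla u,w\rangle$ with $\nabla_v$ the Levi-Civita covariant derivative, $|H_u|$ for the Hilbert–Schmidt norm of $H_u$, $\Delta u=\operatorname{div}\nabla u$, $\Delta_p u=\operatorname{div}(|\nabla u|^{p-2}\nabla u)$ and, where $\nabla u\ne 0$, $$A_u=\frac{H_u(\nabla u,\nabla u)}{|\nabla u|^2},\qquad P^{II}_u(\eta)=|\nabla u|^{p-2}\Delta\eta+(p-2)|\nabla u|^{p-4}H_\eta(\nabla u,\nabla u)$$ (the second-order part of the linearization at $u$ of the $p$-Laplacian). Let $U\subseteq M$ be open and let $u\in C^2(U)$ with $\nabla u\neq 0$ on $U$. Then at every point $x\in U$ at which the second derivatives of $u$ (in local coordinates) are differentiable, in particular at every point of $U$ if $u\in C^3(U)$, $$\frac1p P^{II}_u(|\nabla u|^p)=|\nabla u|^{2(p-2)}\Big\{|\nabla u|^{2-p}\big[\langle\nabla\Delta_p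 u,\nabla u\rangle-(p-2)A_u\,\Delta_p u\big]+|H_u|^2+p(p-2)A_u^2+\operatorname{Ric}(\nabla u,\nabla u)\Big\}.$$ In particular, this equality holds at $x$ if $u$ is an eigenfunction of the $p$-Laplacian near $x$, that is $u$ is $C^2$ near $x$ with $\Delta_p u=-\lambda|u|^{p-2}u$ there for some $\lambda\in\mathbb R$, if $\nabla u(x)\ne0$, and if the second derivatives of $u$ are differentiable at $x$. -/

import Mathlib

open Set Filter Topology Bundle Manifold
open scoped ContDiff

noncomputable section

namespace PBochner

section Christoffel

variable {E : Type*} [NormedAddCommGroup E] [NormedSpace ℝ E]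

set_option synthInstance.maxHeartbeats 200000 in
/-- For a metric `G` on `s ⊆ E`, the Christoffel symbols of the first kind, as the linear form
`k ↦ (1/2) (∂_v G(w, k) + ∂_w G(v, k) - ∂_k G(v, w))`. -/
def christoffelFirst (G : E → E →L[ℝ] E →L[ℝ] ℝ) (s : Set E) (z v w : E) : E →L[ℝ] ℝ :=
  letI D : E →L[ℝ] E →L[ℝ] E →L[ℝ] ℝ := fderivWithin ℝ G s z
  (1 / 2 : ℝ) • (D v w + D w v - (D.flip v).flip w)

/-- The Christoffel symbols of the Levi-Civita connection of `G`: the vector `Γ(v, w)` with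
`G(Γ(v, w), k) = christoffelFirst v w k` for all `k`. -/
def christoffel (G : E → E →L[ℝ] E →L[ℝ] ℝ) (s : Set E) (z v w : E) : E :=
  (G z).inverse (christoffelFirst G s z v w)

/-- The curvature tensor of `G`: `R(a, v) w = ∇_a ∇_v w - ∇_v ∇_a w` for constant fields
`a, v, w`. -/
def curvature (G : E → E →L[ℝ] E →L[ℝ] ℝ) (s : Set E) (z a v w : E) : E :=
  fderivWithin ℝ (fun z' ↦ christoffel G s z' v w) s z a
    - fderivWithin ℝ (fun z' ↦ christoffel G s z' a w) s z v
    + christoffel G s z a (christoffel G s z v w)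
    - christoffel G s z v (christoffel G s z a w)

end Christoffel

section Chart

variable {E : Type*} [NormedAddCommGroup E] [NormedSpace ℝ E]
  {H : Type*} [TopologicalSpace H] (I : ModelWithCorners ℝ E H)
  {M : Type*} [TopologicalSpace M] [ChartedSpace H M] [IsManifold I ∞ M]
  [RiemannianBundle (fun x : M ↦ TangentSpace I x)]

/-- The Riemannian metric in the (extended) chart at `c`, at the point `z` of the model space:
`(v, w) ↦ ⟨d(φ_c⁻¹)_z v, d(φ_c⁻¹)_z w⟩`. On basis vectors these are the coefficients `g_ij`. -/
def chartMetric (c : M) (z : E) : E →L[ℝ] E →L[ℝ] ℝ :=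
  letI T : E →L[ℝ] TangentSpace I ((extChartAt I c).symm z) :=
    mfderivWithin 𝓘(ℝ, E) I (extChartAt I c).symm (range I) z
  (innerSL ℝ (E := TangentSpace I ((extChartAt I c).symm z))).bilinearComp T T

/-- The Levi-Civita covariant derivative `∇_v X` at `x`, computed in the chart at `x`. (The tangent
space at `x` is identified with `E` through the derivative of this chart, by definition.) -/
def covDeriv (X : ∀ y : M, TangentSpace I y) (x : M) (v : TangentSpace I x) : TangentSpace I x :=
  letI Y : E → E := VectorField.mpullbackWithin 𝓘(ℝ, E) I (extChartAt I x).symm X (range I)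
  letI z : E := extChartAt I x x
  letI r : E := fderivWithin ℝ Y (range I) z v + christoffel (chartMetric I x) (range I) z v (Y z)
  r

/-- The second derivatives of `u` (in the chart at `x`) are differentiable at `x`. -/
def ThriceDifferentiableAt (u : M → ℝ) (x : M) : Prop :=
  DifferentiableWithinAt ℝ
    (fderivWithin ℝ (fderivWithin ℝ (u ∘ (extChartAt I x).symm) (range I)) (range I))
    (range I) (extChartAt I x x)

end Chart

instance {E : Type*} [NormedAddCommGroup E] [NormedSpace ℝ E] [FiniteDimensional ℝ E]
    {H : Type*} [TopologicalSpace H] (I : ModelWithCorners ℝ E H)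
    {M : Type*} [TopologicalSpace M] [ChartedSpace H M] (x : M) :
    FiniteDimensional ℝ (TangentSpace I x) :=
  inferInstanceAs (FiniteDimensional ℝ E)

section Operators

variable {E : Type*} [NormedAddCommGroup E] [NormedSpace ℝ E] [FiniteDimensional ℝ E]
  {H : Type*} [TopologicalSpace H] (I : ModelWithCorners ℝ E H)
  {M : Type*} [TopologicalSpace M] [ChartedSpace H M] [IsManifold I ∞ M]
  [RiemannianBundle (fun x : M ↦ TangentSpace I x)]

/-- The Riemannian gradient: `⟨∇u, w⟩ = du(w)`. -/
def grad (u : M → ℝ) (x : M) : TangentSpace I x :=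
  haveI : CompleteSpace (TangentSpace I x) := FiniteDimensional.complete ℝ _
  letI du : TangentSpace I x →L[ℝ] ℝ := mfderiv I 𝓘(ℝ, ℝ) u x
  (InnerProductSpace.toDual ℝ (TangentSpace I x)).symm du

/-- The divergence of a vector field: the trace of `v ↦ ∇_v X`. -/
def divergence (X : ∀ y : M, TangentSpace I y) (x : M) : ℝ :=
  ∑ i, inner ℝ (covDeriv I X x (stdOrthonormalBasis ℝ (TangentSpace I x) i))
    (stdOrthonormalBasis ℝ (TangentSpace I x) i)

/-- The Hessian `H_u(v, w) = ⟨∇_v ∇u, w⟩`. -/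
def hessian (u : M → ℝ) (x : M) (v w : TangentSpace I x) : ℝ :=
  inner ℝ (covDeriv I (grad I u) x v) w

/-- The squared Hilbert-Schmidt norm `|H_u|²` of the Hessian. -/
def hessianNormSq (u : M → ℝ) (x : M) : ℝ :=
  ∑ i, ∑ j, (hessian I u x (stdOrthonormalBasis ℝ (TangentSpace I x) i)
    (stdOrthonormalBasis ℝ (TangentSpace I x) j)) ^ 2

/-- The Laplace-Beltrami operator `Δu = div ∇u`. -/
def laplacian (u : M → ℝ) (x : M) : ℝ := divergence I (grad I u) x

/-- The `p`-Laplacian `Δ_p u = div (|∇u|^(p-2) ∇u)`. -/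
def pLaplacian (p : ℝ) (u : M → ℝ) (x : M) : ℝ :=
  divergence I (fun y ↦ (‖grad I u y‖ ^ (p - 2)) • grad I u y) x

/-- `A_u = H_u(∇u, ∇u) / |∇u|²`. -/
def hessA (u : M → ℝ) (x : M) : ℝ :=
  hessian I u x (grad I u x) (grad I u x) / ‖grad I u x‖ ^ 2

/-- The Ricci curvature `Ric(v, w)`: the trace of `a ↦ R(a, v) w`. -/
def ricci (x : M) (v w : TangentSpace I x) : ℝ :=
  letI R : TangentSpace I x → TangentSpace I x :=
    fun a ↦ curvature (E := E) (chartMetric I x) (range I) (extChartAt I x x) a v w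
  ∑ i, inner ℝ (R (stdOrthonormalBasis ℝ (TangentSpace I x) i))
    (stdOrthonormalBasis ℝ (TangentSpace I x) i)

/-- The second order part of the linearization at `u` of the `p`-Laplacian,
`P^II_u(η) = |∇u|^(p-2) Δη + (p-2) |∇u|^(p-4) H_η(∇u, ∇u)`. -/
def linPLaplacianII (p : ℝ) (u η : M → ℝ) (x : M) : ℝ :=
  ‖grad I u x‖ ^ (p - 2) * laplacian I η x
    + (p - 2) * ‖grad I u x‖ ^ (p - 4) * hessian I η x (grad I u x) (grad I u x)

/-- The `p`-Bochner identity for `u` at the point `x`. -/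
def PBochnerIdentityAt (p : ℝ) (u : M → ℝ) (x : M) : Prop :=
  1 / p * linPLaplacianII I p u (fun y ↦ ‖grad I u y‖ ^ p) x =
    ‖grad I u x‖ ^ (2 * (p - 2)) *
      (‖grad I u x‖ ^ (2 - p) *
          (inner ℝ (grad I (pLaplacian I p u) x) (grad I u x)
            - (p - 2) * hessA I u x * pLaplacian I p u x)
        + hessianNormSq I u x + p * (p - 2) * hessA I u x ^ 2
        + ricci I x (grad I u x) (grad I u x))

end Operators

end PBochner

end

/-!
For a vector field `X` and a torsion-free connection, contracting the Ricci identity gives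
`tr ∇(∇_X X) = d(tr ∇X)(X) + tr((∇X)²) + Ric(X, X)`. Take `X = ∇u`, for which `∇X` is self-adjoint,
and put `A = ⟨∇_X X, X⟩ / |X|²`. Then

* `∇|X|^p = p |X|^(p-2) ∇_X X`, so both terms of `P^II_u(|X|^p)` are expressed through `∇_X X`;
* `div(|X|^(p-2) X) = |X|^(p-2) (tr ∇X + (p-2) A)`;
* `dA(X) = (⟨∇_X ∇_X X, X⟩ + |∇_X X|²) / |X|² - 2 A²`.

The formula follows by eliminating `d(tr ∇X)(X)` and `dA(X)`. Only `X`, its covariant derivative and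
the differentiability of the latter at the one point enter, so three continuous derivatives of `u`
are not needed.
-/

noncomputable section

namespace PBochner

set_option maxSynthPendingDepth 3

section TwiceDifferentiable

variable {E F : Type*} [NormedAddCommGroup E] [NormedSpace ℝ E] [NormedAddCommGroup F]
  [NormedSpace ℝ F] {f : E → F} {s : Set E} {z : E}

/-- `f` is differentiable near `z` and its derivative is differentiable at `z`, both within `s`.
This is the regularity of a gradient field at a point where the potential is only `C²` nearby and
three times differentiable. -/
structure TwiceDifferentiableWithinAt (f : E → F) (s : Set E) (z : E) : Prop where
  eventually : ∀ᶠ y in 𝓝[s] z, DifferentiableWithinAt ℝ f s y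
  fderivWithin : DifferentiableWithinAt ℝ (fderivWithin ℝ f s) s z

theorem TwiceDifferentiableWithinAt.differentiableWithinAt
    (hf : TwiceDifferentiableWithinAt f s z) (hz : z ∈ s) : DifferentiableWithinAt ℝ f s z :=
  hf.eventually.self_of_nhdsWithin hz

theorem eventually_contDiffWithinAt_two (hz : z ∈ s) (hf : ContDiffWithinAt ℝ 2 f s z) :
    ∀ᶠ y in 𝓝[s] z, ContDiffWithinAt ℝ 2 f s y := by
  have h := hf.eventually (by simp)
  rwa [insert_eq_of_mem hz] at h

theorem twiceDifferentiableWithinAt_of_contDiffWithinAt (hs : UniqueDiffOn ℝ s) (hz : z ∈ s)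
    (hf : ContDiffWithinAt ℝ 2 f s z) : TwiceDifferentiableWithinAt f s z where
  eventually := (eventually_contDiffWithinAt_two hz hf).mono fun _ hy ↦
    hy.differentiableWithinAt two_ne_zero
  fderivWithin :=
    (hf.fderivWithin_right (m := 1) hs le_rfl hz).differentiableWithinAt one_ne_zero

theorem TwiceDifferentiableWithinAt.isSymmSndFDerivWithinAt (hs : Convex ℝ s)
    (hne : (interior s).Nonempty) (hz : z ∈ s) (hf : TwiceDifferentiableWithinAt f s z) :
    IsSymmSndFDerivWithinAt ℝ f s z := by
  obtain ⟨ε, hε, hball⟩ := Metric.mem_nhdsWithin_iff.1 hf.eventually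
  have hz_closure : z ∈ closure (interior s) := by
    rw [hs.closure_interior_eq_closure_of_nonempty_interior hne]
    exact subset_closure hz
  have hint : interior (Metric.ball z ε ∩ s) = Metric.ball z ε ∩ interior s := by
    rw [interior_inter, Metric.isOpen_ball.interior_eq]
  refine Convex.second_derivative_within_at_symmetric (s := Metric.ball z ε ∩ s)
    ((convex_ball z ε).inter hs) ?_ (f := f) (f' := _root_.fderivWithin ℝ f s) ?_
    ⟨Metric.mem_ball_self hε, hz⟩ ?_
  · rw [hint]
    exact mem_closure_iff.1 hz_closure _ Metric.isOpen_ball (Metric.mem_ball_self hε)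
  · intro y hy
    rw [hint] at hy
    exact (hball ⟨hy.1, interior_subset hy.2⟩).hasFDerivWithinAt.hasFDerivAt
      (mem_interior_iff_mem_nhds.1 hy.2)
  · exact hf.fderivWithin.hasFDerivWithinAt.mono (interior_subset.trans inter_subset_right)

theorem hasFDerivWithinAt_clm_flip {E₁ E₂ : Type*} [NormedAddCommGroup E₁] [NormedSpace ℝ E₁]
    [NormedAddCommGroup E₂] [NormedSpace ℝ E₂] {c : E → E₁ →L[ℝ] E₂ →L[ℝ] F}
    {c' : E →L[ℝ] E₁ →L[ℝ] E₂ →L[ℝ] F} (hc : HasFDerivWithinAt c c' s z) :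
    HasFDerivWithinAt (fun y ↦ (c y).flip)
      ((ContinuousLinearMap.flipₗᵢ ℝ E₁ E₂ F).toContinuousLinearEquiv.toContinuousLinearMap ∘L c')
      s z :=
  (ContinuousLinearMap.flipₗᵢ ℝ E₁ E₂ F).toContinuousLinearEquiv.toContinuousLinearMap.hasFDerivAt
    |>.comp_hasFDerivWithinAt z hc

end TwiceDifferentiable

section Trace

variable {E : Type*} [NormedAddCommGroup E] [NormedSpace ℝ E] [FiniteDimensional ℝ E]

/-- The trace as a continuous linear form on the continuous endomorphisms. -/
def traceL (E : Type*) [NormedAddCommGroup E] [NormedSpace ℝ E] [FiniteDimensional ℝ E] :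
    (E →L[ℝ] E) →L[ℝ] ℝ :=
  LinearMap.toContinuousLinearMap (LinearMap.trace ℝ E ∘ₗ ContinuousLinearMap.coeLM ℝ)

theorem traceL_comp_comm (A B : E →L[ℝ] E) : traceL E (A ∘L B) = traceL E (B ∘L A) :=
  LinearMap.trace_comp_comm' (B : E →ₗ[ℝ] E) (A : E →ₗ[ℝ] E)

theorem traceL_smulRight (l : E →L[ℝ] ℝ) (x : E) : traceL E (l.smulRight x) = l x :=
  LinearMap.trace_smulRight (l : E →ₗ[ℝ] ℝ) x

end Trace

section Connection

variable {E : Type*} [NormedAddCommGroup E] [NormedSpace ℝ E] {Γ : E → E →L[ℝ] E →L[ℝ] E}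
  {s : Set E} {X Y : E → E} {A : E → E →L[ℝ] E} {z : E}

/-- The covariant derivative `v ↦ ∇_v X` of a vector field on `s`, for the connection with
Christoffel symbols `Γ`. -/
def connDeriv (Γ : E → E →L[ℝ] E →L[ℝ] E) (s : Set E) (X : E → E) (z : E) : E →L[ℝ] E :=
  fderivWithin ℝ X s z + (Γ z).flip (X z)

/-- The covariant derivative `v ↦ ∇_v A` of a field of endomorphisms,
`∇_v A = ∂_v A + [Γ(v), A]`. -/
def connDerivEnd (Γ : E → E →L[ℝ] E →L[ℝ] E) (s : Set E) (A : E → E →L[ℝ] E) (z : E) :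
    E →L[ℝ] E →L[ℝ] E :=
  fderivWithin ℝ A s z + (ContinuousLinearMap.compL ℝ E E E).flip (A z) ∘L Γ z
    - ContinuousLinearMap.compL ℝ E E E (A z) ∘L Γ z

/-- The curvature of the connection with Christoffel symbols `Γ`, as the endomorphism
`a ↦ R(a, v) w` whose trace is the Ricci curvature. -/
def connCurvature (Γ : E → E →L[ℝ] E →L[ℝ] E) (s : Set E) (z v w : E) : E →L[ℝ] E :=
  ((fderivWithin ℝ Γ s z).flip v).flip w - (fderivWithin ℝ Γ s z v).flip w
    + (Γ z).flip (Γ z v w) - Γ z v ∘L (Γ z).flip w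

theorem connDeriv_apply (v : E) :
    connDeriv Γ s X z v = fderivWithin ℝ X s z v + Γ z v (X z) := rfl

theorem connDerivEnd_apply (v w : E) :
    connDerivEnd Γ s A z v w =
      fderivWithin ℝ A s z v w + Γ z v (A z w) - A z (Γ z v w) := by
  simp [connDerivEnd]

theorem connCurvature_apply (a v w : E) :
    connCurvature Γ s z v w a = fderivWithin ℝ Γ s z a v w - fderivWithin ℝ Γ s z v a w
      + Γ z a (Γ z v w) - Γ z v (Γ z a w) := by
  simp [connCurvature]

theorem connDeriv_congr (hz : z ∈ s) (h : X =ᶠ[𝓝[s] z] Y) :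
    connDeriv Γ s X z = connDeriv Γ s Y z := by
  rw [connDeriv, connDeriv, h.fderivWithin_eq_of_mem hz, h.self_of_nhdsWithin hz]

theorem connDeriv_smul {φ : E → ℝ} (hs : UniqueDiffWithinAt ℝ s z)
    (hφ : DifferentiableWithinAt ℝ φ s z) (hX : DifferentiableWithinAt ℝ X s z) :
    connDeriv Γ s (fun y ↦ φ y • X y) z =
      φ z • connDeriv Γ s X z + (fderivWithin ℝ φ s z).smulRight (X z) := by
  ext v
  simp only [connDeriv, fderivWithin_fun_smul hs hφ hX, map_smul, add_apply, smul_apply,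
    ContinuousLinearMap.smulRight_apply, ContinuousLinearMap.flip_apply, smul_add]
  abel

theorem connDeriv_clm_apply (hs : UniqueDiffWithinAt ℝ s z) (hA : DifferentiableWithinAt ℝ A s z)
    (hX : DifferentiableWithinAt ℝ X s z) :
    connDeriv Γ s (fun y ↦ A y (X y)) z =
      (connDerivEnd Γ s A z).flip (X z) + A z ∘L connDeriv Γ s X z := by
  ext v
  simp only [connDeriv, fderivWithin_clm_apply hs hA hX, add_apply, ContinuousLinearMap.comp_apply,
    ContinuousLinearMap.flip_apply, ContinuousLinearMap.comp_add, connDerivEnd_apply,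
    sub_add_add_cancel]
  abel

theorem hasFDerivWithinAt_connDeriv (hz : z ∈ s) (hΓ : DifferentiableWithinAt ℝ Γ s z)
    (hX : TwiceDifferentiableWithinAt X s z) :
    HasFDerivWithinAt (connDeriv Γ s X)
      (fderivWithin ℝ (fderivWithin ℝ X s) s z + ((Γ z).flip ∘L fderivWithin ℝ X s z +
        ((ContinuousLinearMap.flipₗᵢ ℝ E E E).toContinuousLinearEquiv.toContinuousLinearMap ∘L
          fderivWithin ℝ Γ s z).flip (X z))) s z :=
  hX.fderivWithin.hasFDerivWithinAt.add
    ((hasFDerivWithinAt_clm_flip hΓ.hasFDerivWithinAt).clm_apply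
      (hX.differentiableWithinAt hz).hasFDerivWithinAt)

theorem fderivWithin_connDeriv_apply (hs : UniqueDiffWithinAt ℝ s z) (hz : z ∈ s)
    (hΓ : DifferentiableWithinAt ℝ Γ s z) (hX : TwiceDifferentiableWithinAt X s z) (v w : E) :
    fderivWithin ℝ (connDeriv Γ s X) s z v w =
      fderivWithin ℝ (fderivWithin ℝ X s) s z v w + Γ z w (fderivWithin ℝ X s z v)
        + fderivWithin ℝ Γ s z v w (X z) := by
  rw [(hasFDerivWithinAt_connDeriv hz hΓ hX).fderivWithin hs]
  simp only [add_apply, ContinuousLinearMap.comp_apply, ContinuousLinearMap.flip_apply,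
    ContinuousLinearEquiv.coe_coe, LinearIsometryEquiv.coe_toContinuousLinearEquiv,
    ContinuousLinearMap.coe_flipₗᵢ]
  abel

theorem ricci_identity (hs : UniqueDiffWithinAt ℝ s z) (hz : z ∈ s)
    (hΓ : DifferentiableWithinAt ℝ Γ s z) (htorsion : ∀ v w, Γ z v w = Γ z w v)
    (hX : TwiceDifferentiableWithinAt X s z) (hX_symm : IsSymmSndFDerivWithinAt ℝ X s z)
    (v w : E) :
    connDerivEnd Γ s (connDeriv Γ s X) z v w =
      connDerivEnd Γ s (connDeriv Γ s X) z w v + connCurvature Γ s z w (X z) v := by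
  simp only [connDerivEnd_apply, fderivWithin_connDeriv_apply hs hz hΓ hX, connDeriv_apply,
    connCurvature_apply, map_add, hX_symm.eq v w, htorsion v w]
  abel

variable [FiniteDimensional ℝ E]

theorem fderivWithin_traceL_apply (hs : UniqueDiffWithinAt ℝ s z)
    (hA : DifferentiableWithinAt ℝ A s z) (v : E) :
    fderivWithin ℝ (fun y ↦ traceL E (A y)) s z v = traceL E (connDerivEnd Γ s A z v) := by
  have hcomm : connDerivEnd Γ s A z v =
      fderivWithin ℝ A s z v + (Γ z v ∘L A z - A z ∘L Γ z v) := by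
    ext w
    simp [connDerivEnd_apply, add_sub_assoc]
  have hderiv : HasFDerivWithinAt (fun y ↦ traceL E (A y)) (traceL E ∘L fderivWithin ℝ A s z) s z :=
    (traceL E).hasFDerivAt.comp_hasFDerivWithinAt z hA.hasFDerivWithinAt
  rw [hderiv.fderivWithin hs, hcomm, map_add, map_sub, traceL_comp_comm (A z), sub_self, add_zero,
    ContinuousLinearMap.comp_apply]

/-- The trace of the Ricci identity; it is the source of the Ricci term in Bochner formulas. -/
theorem traceL_connDeriv_connDeriv_self (hs : UniqueDiffWithinAt ℝ s z) (hz : z ∈ s)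
    (hΓ : DifferentiableWithinAt ℝ Γ s z) (htorsion : ∀ v w, Γ z v w = Γ z w v)
    (hX : TwiceDifferentiableWithinAt X s z) (hX_symm : IsSymmSndFDerivWithinAt ℝ X s z) :
    traceL E (connDeriv Γ s (fun y ↦ connDeriv Γ s X y (X y)) z) =
      fderivWithin ℝ (fun y ↦ traceL E (connDeriv Γ s X y)) s z (X z)
        + traceL E (connDeriv Γ s X z ∘L connDeriv Γ s X z)
        + traceL E (connCurvature Γ s z (X z) (X z)) := by
  have hB : DifferentiableWithinAt ℝ (connDeriv Γ s X) s z :=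
    (hasFDerivWithinAt_connDeriv hz hΓ hX).differentiableWithinAt
  have hcodazzi : (connDerivEnd Γ s (connDeriv Γ s X) z).flip (X z) =
      connDerivEnd Γ s (connDeriv Γ s X) z (X z) + connCurvature Γ s z (X z) (X z) := by
    ext v
    exact ricci_identity hs hz hΓ htorsion hX hX_symm v (X z)
  rw [connDeriv_clm_apply hs hB (hX.differentiableWithinAt hz), hcodazzi,
    fderivWithin_traceL_apply (Γ := Γ) hs hB]
  simp only [map_add]
  ring

end Connection

section ChristoffelSymbols

variable {E : Type*} [NormedAddCommGroup E] [NormedSpace ℝ E]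

/-- The Christoffel symbols of the first kind, bundled as a trilinear form, as a function of the
derivative `D` of the metric. -/
def christoffelFirstL (D : E →L[ℝ] E →L[ℝ] E →L[ℝ] ℝ) : E →L[ℝ] E →L[ℝ] E →L[ℝ] ℝ :=
  (1 / 2 : ℝ) • (D + D.flip -
    (ContinuousLinearMap.flipₗᵢ ℝ E E ℝ).toContinuousLinearEquiv.toContinuousLinearMap ∘L D.flip)

/-- The Levi-Civita connection of `G`, given by its Christoffel symbols `christoffel` bundled as a
bilinear map. -/
def leviCivita (G : E → E →L[ℝ] E →L[ℝ] ℝ) (s : Set E) (z : E) : E →L[ℝ] E →L[ℝ] E :=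
  (ContinuousLinearMap.compL ℝ E (E →L[ℝ] ℝ) E (G z).inverse) ∘L
    christoffelFirstL (fderivWithin ℝ G s z)

theorem christoffelFirstL_apply (D : E →L[ℝ] E →L[ℝ] E →L[ℝ] ℝ) (v w k : E) :
    christoffelFirstL D v w k = 1 / 2 * (D v w k + D w v k - D k v w) := by
  simp [christoffelFirstL]

theorem leviCivita_apply (G : E → E →L[ℝ] E →L[ℝ] ℝ) (s : Set E) (z v w : E) :
    leviCivita G s z v w = christoffel G s z v w := by
  simp [leviCivita, christoffel, christoffelFirst, christoffelFirstL]

end ChristoffelSymbols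

local notation "∇[" G ", " s "]" => connDeriv (leviCivita G s) s

section LeviCivita

variable {E : Type*} [NormedAddCommGroup E] [NormedSpace ℝ E]

/-- `G` is a pseudo-Riemannian metric on `s` of class `C²` near `z`. -/
structure IsMetricAt (G : E → E →L[ℝ] E →L[ℝ] ℝ) (s : Set E) (z : E) : Prop where
  contDiff : ContDiffWithinAt ℝ 2 G s z
  symm : ∀ᶠ y in 𝓝[s] z, ∀ v w, G y v w = G y w v
  isInvertible : ∀ᶠ y in 𝓝[s] z, (G y).IsInvertible

variable {G : E → E →L[ℝ] E →L[ℝ] ℝ} {s : Set E} {X Y : E → E} {z : E}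

theorem IsMetricAt.eventually (hG : IsMetricAt G s z) (hz : z ∈ s) :
    ∀ᶠ y in 𝓝[s] z, IsMetricAt G s y := by
  filter_upwards [eventually_contDiffWithinAt_two hz hG.contDiff,
    eventually_eventually_nhdsWithin.2 hG.symm,
    eventually_eventually_nhdsWithin.2 hG.isInvertible] with y h₁ h₂ h₃ using ⟨h₁, h₂, h₃⟩

theorem IsMetricAt.differentiableWithinAt (hG : IsMetricAt G s z) :
    DifferentiableWithinAt ℝ G s z :=
  hG.contDiff.differentiableWithinAt two_ne_zero

theorem IsMetricAt.differentiableWithinAt_inverse [CompleteSpace E] (hG : IsMetricAt G s z)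
    (hz : z ∈ s) : DifferentiableWithinAt ℝ (fun y ↦ (G y).inverse) s z :=
  ((hG.isInvertible.self_of_nhdsWithin hz).contDiffAt_map_inverse (n := 1)).differentiableAt
    one_ne_zero |>.comp_differentiableWithinAt z hG.differentiableWithinAt

theorem metric_leviCivita_apply (hG : (G z).IsInvertible) (v w k : E) :
    G z (leviCivita G s z v w) k = 1 / 2 * (fderivWithin ℝ G s z v w k +
      fderivWithin ℝ G s z w v k - fderivWithin ℝ G s z k v w) := by
  obtain ⟨e, he⟩ := hG
  rw [← christoffelFirstL_apply]
  simp [leviCivita, ← he]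

theorem IsMetricAt.fderivWithin_symm (hG : IsMetricAt G s z) (hs : UniqueDiffWithinAt ℝ s z)
    (hz : z ∈ s) (k v w : E) : fderivWithin ℝ G s z k v w = fderivWithin ℝ G s z k w v := by
  have hflip : HasFDerivWithinAt G _ s z :=
    (hasFDerivWithinAt_clm_flip hG.differentiableWithinAt.hasFDerivWithinAt).congr_of_eventuallyEq
      (hG.symm.mono fun y hy ↦ by ext v w; simp [hy v w])
      (by ext v w; simp [hG.symm.self_of_nhdsWithin hz v w])
  conv_lhs => rw [hflip.fderivWithin hs]
  simp

theorem IsMetricAt.leviCivita_symm (hG : IsMetricAt G s z) (hs : UniqueDiffWithinAt ℝ s z)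
    (hz : z ∈ s) (v w : E) : leviCivita G s z v w = leviCivita G s z w v := by
  have hfirst : christoffelFirstL (fderivWithin ℝ G s z) v w =
      christoffelFirstL (fderivWithin ℝ G s z) w v := by
    ext k
    rw [christoffelFirstL_apply, christoffelFirstL_apply, hG.fderivWithin_symm hs hz k v w]
    ring
  simp [leviCivita, hfirst]

theorem IsMetricAt.fderivWithin_apply (hG : IsMetricAt G s z) (hs : UniqueDiffWithinAt ℝ s z)
    (hz : z ∈ s) (v w k : E) :
    fderivWithin ℝ G s z v w k =
      G z (leviCivita G s z v w) k + G z w (leviCivita G s z v k) := by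
  have hinv := hG.isInvertible.self_of_nhdsWithin hz
  rw [hG.symm.self_of_nhdsWithin hz w, metric_leviCivita_apply hinv, metric_leviCivita_apply hinv,
    hG.fderivWithin_symm hs hz v k w]
  ring

theorem eq_leviCivita_of_symm_of_compatible (hinv : (G z).IsInvertible)
    (hsymm : ∀ v w, G z v w = G z w v) {Γ : E → E → E} (htorsion : ∀ v w, Γ v w = Γ w v)
    (hcompat : ∀ v w k, fderivWithin ℝ G s z v w k = G z (Γ v w) k + G z w (Γ v k)) (v w : E) :
    Γ v w = leviCivita G s z v w := by
  apply hinv.injective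
  ext k
  rw [metric_leviCivita_apply hinv, hcompat, hcompat, hcompat, htorsion w v, htorsion w k,
    htorsion k v, hsymm w, hsymm (Γ v k) w, htorsion k w, hsymm v]
  ring

theorem IsMetricAt.differentiableWithinAt_leviCivita [CompleteSpace E] (hG : IsMetricAt G s z)
    (hs : UniqueDiffOn ℝ s) (hz : z ∈ s) : DifferentiableWithinAt ℝ (leviCivita G s) s z := by
  have hderiv : DifferentiableWithinAt ℝ (fderivWithin ℝ G s) s z :=
    (twiceDifferentiableWithinAt_of_contDiffWithinAt hs hz hG.contDiff).fderivWithin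
  have hflip : DifferentiableWithinAt ℝ (fun y ↦ (fderivWithin ℝ G s y).flip) s z :=
    (hasFDerivWithinAt_clm_flip hderiv.hasFDerivWithinAt).differentiableWithinAt
  unfold leviCivita christoffelFirstL
  exact ((ContinuousLinearMap.compL ℝ E (E →L[ℝ] ℝ) E).differentiableAt.comp_differentiableWithinAt
    z (hG.differentiableWithinAt_inverse hz)).clm_comp (((hderiv.fun_add hflip).fun_sub
      ((differentiableWithinAt_const _).clm_comp hflip)).fun_const_smul _)

theorem IsMetricAt.hasFDerivWithinAt_apply (hG : IsMetricAt G s z)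
    (hs : UniqueDiffWithinAt ℝ s z) (hz : z ∈ s) (hX : DifferentiableWithinAt ℝ X s z)
    (hY : DifferentiableWithinAt ℝ Y s z) :
    HasFDerivWithinAt (fun y ↦ G y (X y) (Y y))
      ((G z).flip (Y z) ∘L ∇[G, s] X z + G z (X z) ∘L ∇[G, s] Y z) s z := by
  refine ((hG.differentiableWithinAt.hasFDerivWithinAt.clm_apply hX.hasFDerivWithinAt).clm_apply
    hY.hasFDerivWithinAt).congr_fderiv ?_
  ext v
  simp only [ContinuousLinearMap.flip_add, add_apply, ContinuousLinearMap.comp_apply,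
    ContinuousLinearMap.flip_apply, hG.fderivWithin_apply hs hz, connDeriv_apply, map_add]
  ring

theorem IsMetricAt.connCurvature_leviCivita_apply [CompleteSpace E] (hG : IsMetricAt G s z)
    (hs : UniqueDiffOn ℝ s) (hz : z ∈ s) (a v w : E) :
    connCurvature (leviCivita G s) s z v w a = curvature G s z a v w := by
  have hΓ := (hG.differentiableWithinAt_leviCivita hs hz).hasFDerivWithinAt
  have hderiv : ∀ v w k, fderivWithin ℝ (fun y ↦ christoffel G s y v w) s z k =
      fderivWithin ℝ (leviCivita G s) s z k v w := by
    intro v w k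
    simp only [← leviCivita_apply]
    rw [((hΓ.clm_apply (hasFDerivWithinAt_const v z s)).clm_apply
      (hasFDerivWithinAt_const w z s)).fderivWithin (hs z hz)]
    simp
  simp only [connCurvature_apply, curvature, hderiv, leviCivita_apply]

end LeviCivita

section CoordinateChange

variable {E : Type*} [NormedAddCommGroup E] [NormedSpace ℝ E]

/-- Near `z`, the map `ψ` is a `C²` change of coordinates from `s` to `t` under which the metric
`G` pulls back to `G'`. -/
structure IsLocalIsometryAt (ψ : E → E) (G' G : E → E →L[ℝ] E →L[ℝ] ℝ) (s t : Set E) (z : E) :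
    Prop where
  contDiff : ContDiffWithinAt ℝ 2 ψ s z
  mapsTo : ∀ᶠ y in 𝓝[s] z, ψ y ∈ t
  isInvertible : ∀ᶠ y in 𝓝[s] z, (fderivWithin ℝ ψ s y).IsInvertible
  pullback : ∀ᶠ y in 𝓝[s] z, ∀ v w,
    G' y v w = G (ψ y) (fderivWithin ℝ ψ s y v) (fderivWithin ℝ ψ s y w)

variable {G G' : E → E →L[ℝ] E →L[ℝ] ℝ} {s t : Set E} {ψ : E → E} {z : E}

theorem IsLocalIsometryAt.tendsto (hψ : IsLocalIsometryAt ψ G' G s t z) :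
    Tendsto ψ (𝓝[s] z) (𝓝[t] (ψ z)) :=
  tendsto_nhdsWithin_iff.2 ⟨hψ.contDiff.continuousWithinAt, hψ.mapsTo⟩

theorem IsLocalIsometryAt.hasFDerivWithinAt_comp {F : Type*} [NormedAddCommGroup F]
    [NormedSpace ℝ F] {f : E → F} (hψ : IsLocalIsometryAt ψ G' G s t z)
    (hf : DifferentiableWithinAt ℝ f t (ψ z)) :
    HasFDerivWithinAt (f ∘ ψ) (fderivWithin ℝ f t (ψ z) ∘L fderivWithin ℝ ψ s z) s z :=
  hf.hasFDerivWithinAt.comp_of_tendsto z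
    (hψ.contDiff.differentiableWithinAt two_ne_zero).hasFDerivWithinAt hψ.tendsto

theorem IsLocalIsometryAt.hasFDerivWithinAt_fderivWithin (hψ : IsLocalIsometryAt ψ G' G s t z)
    (hs : UniqueDiffOn ℝ s) (hz : z ∈ s) :
    HasFDerivWithinAt (fderivWithin ℝ ψ s) (fderivWithin ℝ (fderivWithin ℝ ψ s) s z) s z :=
  (twiceDifferentiableWithinAt_of_contDiffWithinAt hs hz hψ.contDiff).fderivWithin.hasFDerivWithinAt

theorem IsLocalIsometryAt.fderivWithin_metric (hψ : IsLocalIsometryAt ψ G' G s t z)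
    (hs : UniqueDiffOn ℝ s) (hz : z ∈ s) (hG : DifferentiableWithinAt ℝ G t (ψ z)) (v w k : E) :
    letI A := fderivWithin ℝ ψ s z
    letI A' := fderivWithin ℝ (fderivWithin ℝ ψ s) s z
    fderivWithin ℝ G' s z v w k = fderivWithin ℝ G t (ψ z) (A v) (A w) (A k)
      + G (ψ z) (A' v w) (A k) + G (ψ z) (A w) (A' v k) := by
  have hA := hψ.hasFDerivWithinAt_fderivWithin hs hz
  have hprecomp : HasFDerivWithinAt
      (fun y ↦ (ContinuousLinearMap.compL ℝ E E ℝ).flip (fderivWithin ℝ ψ s y)) _ s z :=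
    (ContinuousLinearMap.compL ℝ E E ℝ).flip.hasFDerivAt.comp_hasFDerivWithinAt z hA
  have hpullback : HasFDerivWithinAt G' _ s z :=
    (hprecomp.clm_comp ((hψ.hasFDerivWithinAt_comp hG).clm_comp hA)).congr_of_eventuallyEq
      (hψ.pullback.mono fun y hy ↦ by ext v w; simp [hy v w])
      (by ext v w; simp [hψ.pullback.self_of_nhdsWithin hz v w])
  rw [hpullback.fderivWithin (hs z hz)]
  simp only [Function.comp_apply, ContinuousLinearMap.comp_add, add_apply,
    ContinuousLinearMap.comp_apply, ContinuousLinearMap.compL_apply, ContinuousLinearMap.flip_apply,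
    add_left_inj]
  ring

/-- The transformation law follows from the uniqueness of the Levi-Civita connection: the right hand
side, transported to the source, is a torsion-free connection compatible with `G'`. -/
theorem IsLocalIsometryAt.fderivWithin_leviCivita (hψ : IsLocalIsometryAt ψ G' G s t z)
    (hs : UniqueDiffOn ℝ s) (ht : UniqueDiffOn ℝ t) (hz : z ∈ s)
    (hψ_symm : IsSymmSndFDerivWithinAt ℝ ψ s z) (hG : IsMetricAt G t (ψ z))
    (hG' : (G' z).IsInvertible) (v w : E) :
    fderivWithin ℝ ψ s z (leviCivita G' s z v w) =
      fderivWithin ℝ (fderivWithin ℝ ψ s) s z v w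
        + leviCivita G t (ψ z) (fderivWithin ℝ ψ s z v) (fderivWithin ℝ ψ s z w) := by
  have hψz : ψ z ∈ t := hψ.mapsTo.self_of_nhdsWithin hz
  have hpullback := hψ.pullback.self_of_nhdsWithin hz
  have hsymm := hG.symm.self_of_nhdsWithin hψz
  set A := fderivWithin ℝ ψ s z with hA
  set A' := fderivWithin ℝ (fderivWithin ℝ ψ s) s z with hA'
  obtain ⟨e, he⟩ := hψ.isInvertible.self_of_nhdsWithin hz
  rw [← hA] at he
  have hA_symm : ∀ v, A (e.symm v) = v := fun v ↦ by simp [← he]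
  rw [← eq_leviCivita_of_symm_of_compatible hG' (fun v w ↦ by rw [hpullback, hpullback, hsymm])
    (Γ := fun v w ↦ e.symm (A' v w + leviCivita G t (ψ z) (A v) (A w))) ?_ ?_ v w, hA_symm]
  · intro v w
    rw [hA', hψ_symm.eq, hG.leviCivita_symm (ht _ hψz) hψz]
  · intro v w k
    rw [hψ.fderivWithin_metric hs hz hG.differentiableWithinAt, hpullback, hpullback, ← hA, ← hA',
      hA_symm, hA_symm, hG.fderivWithin_apply (ht _ hψz) hψz]
    simp only [map_add, add_apply]
    ring

variable {Y Y' : E → E}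

theorem IsLocalIsometryAt.differentiableWithinAt_field [CompleteSpace E]
    (hψ : IsLocalIsometryAt ψ G' G s t z) (hs : UniqueDiffOn ℝ s) (hz : z ∈ s)
    (hY : DifferentiableWithinAt ℝ Y t (ψ z))
    (hY' : ∀ᶠ y in 𝓝[s] z, fderivWithin ℝ ψ s y (Y' y) = Y (ψ y)) :
    DifferentiableWithinAt ℝ Y' s z := by
  have hinverse : DifferentiableWithinAt ℝ (fun y ↦ (fderivWithin ℝ ψ s y).inverse) s z :=
    ((hψ.isInvertible.self_of_nhdsWithin hz).contDiffAt_map_inverse (n := 1)).differentiableAt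
      one_ne_zero |>.comp_differentiableWithinAt z
      (hψ.hasFDerivWithinAt_fderivWithin hs hz).differentiableWithinAt
  have heq : ∀ᶠ y in 𝓝[s] z, Y' y = (fderivWithin ℝ ψ s y).inverse ((Y ∘ ψ) y) := by
    filter_upwards [hY', hψ.isInvertible] with y hy hinv
    rw [Function.comp_apply, ← hy, hinv.inverse_apply_self]
  exact (hinverse.clm_apply (hψ.hasFDerivWithinAt_comp hY).differentiableWithinAt)
    |>.congr_of_eventuallyEq heq (heq.self_of_nhdsWithin hz)

theorem IsLocalIsometryAt.fderivWithin_connDeriv [CompleteSpace E]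
    (hψ : IsLocalIsometryAt ψ G' G s t z) (hs : UniqueDiffOn ℝ s) (ht : UniqueDiffOn ℝ t)
    (hz : z ∈ s) (hψ_symm : IsSymmSndFDerivWithinAt ℝ ψ s z) (hG : IsMetricAt G t (ψ z))
    (hG' : (G' z).IsInvertible) (hY : DifferentiableWithinAt ℝ Y t (ψ z))
    (hY' : ∀ᶠ y in 𝓝[s] z, fderivWithin ℝ ψ s y (Y' y) = Y (ψ y)) (v : E) :
    fderivWithin ℝ ψ s z (∇[G', s] Y' z v) = ∇[G, t] Y (ψ z) (fderivWithin ℝ ψ s z v) := by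
  have hY'_diff := hψ.differentiableWithinAt_field hs hz hY hY'
  have hderiv := ((hψ.hasFDerivWithinAt_fderivWithin hs hz).clm_apply
    hY'_diff.hasFDerivWithinAt).congr_of_eventuallyEq (f₁ := Y ∘ ψ)
    (hY'.mono fun y hy ↦ hy.symm) (hY'.self_of_nhdsWithin hz).symm
  have heq := DFunLike.congr_fun ((hs z hz).eq hderiv (hψ.hasFDerivWithinAt_comp hY)) v
  simp only [add_apply, ContinuousLinearMap.comp_apply, ContinuousLinearMap.flip_apply] at heq
  rw [connDeriv_apply, connDeriv_apply, map_add,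
    hψ.fderivWithin_leviCivita hs ht hz hψ_symm hG hG', ← heq, hY'.self_of_nhdsWithin hz]
  abel

theorem IsLocalIsometryAt.traceL_connDeriv [FiniteDimensional ℝ E]
    (hψ : IsLocalIsometryAt ψ G' G s t z) (hs : UniqueDiffOn ℝ s) (ht : UniqueDiffOn ℝ t)
    (hz : z ∈ s) (hψ_symm : IsSymmSndFDerivWithinAt ℝ ψ s z) (hG : IsMetricAt G t (ψ z))
    (hG' : (G' z).IsInvertible) (hY : DifferentiableWithinAt ℝ Y t (ψ z))
    (hY' : ∀ᶠ y in 𝓝[s] z, fderivWithin ℝ ψ s y (Y' y) = Y (ψ y)) :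
    traceL E (∇[G', s] Y' z) = traceL E (∇[G, t] Y (ψ z)) := by
  have : CompleteSpace E := FiniteDimensional.complete ℝ E
  obtain ⟨e, he⟩ := hψ.isInvertible.self_of_nhdsWithin hz
  have hconj : ∇[G', s] Y' z =
      (e.symm : E →L[ℝ] E) ∘L (∇[G, t] Y (ψ z) ∘L (e : E →L[ℝ] E)) := by
    ext v
    have h := hψ.fderivWithin_connDeriv hs ht hz hψ_symm hG hG' hY hY' v
    rw [← he] at h
    simpa using congrArg e.symm h
  rw [hconj, traceL_comp_comm]
  congr 1
  ext v
  simp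

end CoordinateChange

section FieldCalculus

variable {E : Type*} [NormedAddCommGroup E] [NormedSpace ℝ E]

/-- The length of `v` with respect to the bilinear form `B`; it is `0` when `B v v < 0`. -/
def formNorm (B : E →L[ℝ] E →L[ℝ] ℝ) (v : E) : ℝ := √(B v v)

/-- The quantity `⟨∇_X X, X⟩ / |X|²` attached to a vector field; it is `A_u` for `X = ∇u`. -/
def rayleigh (G : E → E →L[ℝ] E →L[ℝ] ℝ) (s : Set E) (X : E → E) (z : E) : ℝ :=
  G z (∇[G, s] X z (X z)) (X z) / formNorm (G z) (X z) ^ 2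

/-- The divergence of `|X|^r X`, expanded by the Leibniz rule for `∇X` self-adjoint. -/
def weightedDivergence [FiniteDimensional ℝ E] (G : E → E →L[ℝ] E →L[ℝ] ℝ) (s : Set E)
    (X : E → E) (r : ℝ) (z : E) : ℝ :=
  formNorm (G z) (X z) ^ r * (traceL E (∇[G, s] X z) + r * rayleigh G s X z)

/-- The covariant derivative of the field `X` at `z` is self-adjoint, as for a gradient, and
`X z` has positive squared length. -/
structure IsSelfAdjointFieldAt (G : E → E →L[ℝ] E →L[ℝ] ℝ) (s : Set E) (X : E → E) (z : E) :
    Prop where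
  differentiableWithinAt : DifferentiableWithinAt ℝ X s z
  selfAdjoint : ∀ v w, G z (∇[G, s] X z v) w = G z (∇[G, s] X z w) v
  pos : 0 < G z (X z) (X z)

theorem formNorm_pos {B : E →L[ℝ] E →L[ℝ] ℝ} {v : E} (h : 0 < B v v) : 0 < formNorm B v :=
  Real.sqrt_pos.2 h

variable {G : E → E →L[ℝ] E →L[ℝ] ℝ} {s : Set E} {X : E → E} {z : E}

theorem IsMetricAt.hasFDerivWithinAt_formNorm_rpow (hG : IsMetricAt G s z)
    (hs : UniqueDiffWithinAt ℝ s z) (hz : z ∈ s)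
    (hX : IsSelfAdjointFieldAt G s X z) (r : ℝ) :
    HasFDerivWithinAt (fun y ↦ formNorm (G y) (X y) ^ r)
      ((r * formNorm (G z) (X z) ^ (r - 2)) • G z (∇[G, s] X z (X z))) s z := by
  have hn : 0 < formNorm (G z) (X z) := formNorm_pos hX.pos
  have hsq : HasFDerivWithinAt (fun y ↦ G y (X y) (X y))
      ((2 : ℝ) • G z (∇[G, s] X z (X z))) s z := by
    refine (hG.hasFDerivWithinAt_apply hs hz hX.differentiableWithinAt
      hX.differentiableWithinAt).congr_fderiv ?_
    ext v
    simp only [add_apply, ContinuousLinearMap.comp_apply, ContinuousLinearMap.flip_apply,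
      hX.selfAdjoint v, hG.symm.self_of_nhdsWithin hz (X z), smul_apply, smul_eq_mul]
    ring
  refine ((hsq.sqrt hX.pos.ne').rpow_const
    (Or.inl hn.ne') (p := r)).congr_fderiv ?_
  change (r * formNorm (G z) (X z) ^ (r - 1)) • (1 / (2 * formNorm (G z) (X z))) • _ = _
  have hexp : formNorm (G z) (X z) ^ (r - 1) =
      formNorm (G z) (X z) ^ (r - 2) * formNorm (G z) (X z) := by
    rw [← Real.rpow_add_one hn.ne']
    ring_nf
  rw [hexp, smul_smul, smul_smul]
  congr 1
  field_simp

theorem IsMetricAt.fderivWithin_formNorm_rpow_self (hG : IsMetricAt G s z)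
    (hs : UniqueDiffWithinAt ℝ s z) (hz : z ∈ s)
    (hX : IsSelfAdjointFieldAt G s X z) (r : ℝ) :
    fderivWithin ℝ (fun y ↦ formNorm (G y) (X y) ^ r) s z (X z) =
      r * formNorm (G z) (X z) ^ r * rayleigh G s X z := by
  have hn : 0 < formNorm (G z) (X z) := formNorm_pos hX.pos
  rw [(hG.hasFDerivWithinAt_formNorm_rpow hs hz hX r).fderivWithin hs,
    Real.rpow_sub hn, Real.rpow_two, rayleigh]
  simp only [smul_apply, smul_eq_mul]
  ring

theorem IsMetricAt.connDeriv_formNorm_rpow_smul (hG : IsMetricAt G s z)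
    (hs : UniqueDiffWithinAt ℝ s z) (hz : z ∈ s)
    (hX : IsSelfAdjointFieldAt G s X z) {Y : E → E} (hY : DifferentiableWithinAt ℝ Y s z)
    (r : ℝ) :
    ∇[G, s] (fun y ↦ formNorm (G y) (X y) ^ r • Y y) z =
      formNorm (G z) (X z) ^ r • (∇[G, s] Y z +
        ((r / formNorm (G z) (X z) ^ 2) • G z (∇[G, s] X z (X z))).smulRight (Y z)) := by
  have hnorm := hG.hasFDerivWithinAt_formNorm_rpow hs hz hX r
  rw [connDeriv_smul hs hnorm.differentiableWithinAt hY, hnorm.fderivWithin hs,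
    Real.rpow_sub (formNorm_pos hX.pos), Real.rpow_two]
  ext v
  simp only [add_apply, smul_apply, ContinuousLinearMap.smulRight_apply, smul_eq_mul, smul_add,
    add_right_inj]
  module

theorem IsMetricAt.traceL_connDeriv_formNorm_rpow_smul_self [FiniteDimensional ℝ E]
    (hG : IsMetricAt G s z) (hs : UniqueDiffWithinAt ℝ s z) (hz : z ∈ s)
    (hX : IsSelfAdjointFieldAt G s X z) (r : ℝ) :
    traceL E (∇[G, s] (fun y ↦ formNorm (G y) (X y) ^ r • X y) z) =
      weightedDivergence G s X r z := by
  rw [hG.connDeriv_formNorm_rpow_smul hs hz hX hX.differentiableWithinAt, map_smul, map_add,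
    traceL_smulRight, weightedDivergence, rayleigh]
  simp only [smul_apply, smul_eq_mul]
  ring

theorem IsMetricAt.differentiableWithinAt_connDeriv_self [CompleteSpace E] (hG : IsMetricAt G s z)
    (hs : UniqueDiffOn ℝ s) (hz : z ∈ s) (hX : TwiceDifferentiableWithinAt X s z) :
    DifferentiableWithinAt ℝ (fun y ↦ ∇[G, s] X y (X y)) s z :=
  (hasFDerivWithinAt_connDeriv hz (hG.differentiableWithinAt_leviCivita hs hz)
    hX).differentiableWithinAt.clm_apply (hX.differentiableWithinAt hz)

theorem IsMetricAt.hasFDerivWithinAt_rayleigh [CompleteSpace E] (hG : IsMetricAt G s z)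
    (hs : UniqueDiffOn ℝ s) (hz : z ∈ s) (hX : IsSelfAdjointFieldAt G s X z)
    (hX₂ : TwiceDifferentiableWithinAt X s z) :
    HasFDerivWithinAt (rayleigh G s X)
      ((formNorm (G z) (X z) ^ 2)⁻¹ •
        ((G z).flip (X z) ∘L ∇[G, s] (fun y ↦ ∇[G, s] X y (X y)) z
          + G z (∇[G, s] X z (X z)) ∘L ∇[G, s] X z
          - (2 * rayleigh G s X z) • G z (∇[G, s] X z (X z)))) s z := by
  have hnum := hG.hasFDerivWithinAt_apply (hs z hz) hz
    (hG.differentiableWithinAt_connDeriv_self hs hz hX₂) hX.differentiableWithinAt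
  have hden : HasFDerivWithinAt (fun y ↦ formNorm (G y) (X y) ^ 2) _ s z :=
    ((hG.hasFDerivWithinAt_formNorm_rpow (hs z hz) hz hX 2).congr_of_eventuallyEq
      (.of_forall fun y ↦ (Real.rpow_two _).symm) (Real.rpow_two _).symm)
  refine (hnum.fun_mul ((hasDerivAt_inv (pow_pos (formNorm_pos hX.pos) 2).ne')
    |>.comp_hasFDerivWithinAt z hden)).congr_fderiv ?_
  ext v
  simp only [sub_self, Real.rpow_zero, mul_one, neg_smul, smul_neg, Function.comp_apply, smul_add,
    add_apply, neg_apply, smul_apply, smul_eq_mul, ContinuousLinearMap.comp_apply,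
    ContinuousLinearMap.flip_apply, rayleigh, sub_apply]
  ring

theorem IsMetricAt.fderivWithin_rayleigh_self [CompleteSpace E] (hG : IsMetricAt G s z)
    (hs : UniqueDiffOn ℝ s) (hz : z ∈ s) (hX : IsSelfAdjointFieldAt G s X z)
    (hX₂ : TwiceDifferentiableWithinAt X s z) :
    fderivWithin ℝ (rayleigh G s X) s z (X z) =
      (G z (∇[G, s] (fun y ↦ ∇[G, s] X y (X y)) z (X z)) (X z)
        + G z (∇[G, s] X z (X z)) (∇[G, s] X z (X z))) / formNorm (G z) (X z) ^ 2
      - 2 * rayleigh G s X z ^ 2 := by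
  rw [(hG.hasFDerivWithinAt_rayleigh hs hz hX hX₂).fderivWithin (hs z hz)]
  simp only [rayleigh, smul_apply, sub_apply, add_apply, ContinuousLinearMap.comp_apply,
    ContinuousLinearMap.flip_apply, smul_eq_mul]
  ring

variable [FiniteDimensional ℝ E]

theorem IsMetricAt.differentiableWithinAt_traceL_connDeriv (hG : IsMetricAt G s z)
    (hs : UniqueDiffOn ℝ s) (hz : z ∈ s) (hX : TwiceDifferentiableWithinAt X s z) :
    DifferentiableWithinAt ℝ (fun y ↦ traceL E (∇[G, s] X y)) s z :=
  have : CompleteSpace E := FiniteDimensional.complete ℝ E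
  (traceL E).differentiableAt.comp_differentiableWithinAt z (hasFDerivWithinAt_connDeriv hz
    (hG.differentiableWithinAt_leviCivita hs hz) hX).differentiableWithinAt

theorem IsMetricAt.hasFDerivWithinAt_weightedDivergence (hG : IsMetricAt G s z)
    (hs : UniqueDiffOn ℝ s) (hz : z ∈ s) (hX : IsSelfAdjointFieldAt G s X z)
    (hX₂ : TwiceDifferentiableWithinAt X s z) (r : ℝ) :
    HasFDerivWithinAt (weightedDivergence G s X r)
      (formNorm (G z) (X z) ^ r • (fderivWithin ℝ (fun y ↦ traceL E (∇[G, s] X y)) s z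
          + r • fderivWithin ℝ (rayleigh G s X) s z)
        + (traceL E (∇[G, s] X z) + r * rayleigh G s X z) •
          fderivWithin ℝ (fun y ↦ formNorm (G y) (X y) ^ r) s z) s z :=
  have : CompleteSpace E := FiniteDimensional.complete ℝ E
  (hG.hasFDerivWithinAt_formNorm_rpow (hs z hz) hz hX
    r).differentiableWithinAt.hasFDerivWithinAt.mul
    ((hG.differentiableWithinAt_traceL_connDeriv hs hz hX₂).hasFDerivWithinAt.add
      ((hG.hasFDerivWithinAt_rayleigh hs hz hX
        hX₂).differentiableWithinAt.hasFDerivWithinAt.const_mul r))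

/-- Since `∂_X |X|^r = r A |X|^r`, subtracting `r A div (|X|^r X)` removes the derivative of the
factor `|X|^r`. -/
theorem IsMetricAt.fderivWithin_weightedDivergence_self_sub (hG : IsMetricAt G s z)
    (hs : UniqueDiffOn ℝ s) (hz : z ∈ s) (hX : IsSelfAdjointFieldAt G s X z)
    (hX₂ : TwiceDifferentiableWithinAt X s z) (r : ℝ) :
    fderivWithin ℝ (weightedDivergence G s X r) s z (X z)
        - r * rayleigh G s X z * weightedDivergence G s X r z =
      formNorm (G z) (X z) ^ r * (fderivWithin ℝ (fun y ↦ traceL E (∇[G, s] X y)) s z (X z)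
        + r * fderivWithin ℝ (rayleigh G s X) s z (X z)) := by
  rw [(hG.hasFDerivWithinAt_weightedDivergence hs hz hX hX₂ r).fderivWithin (hs z hz),
    weightedDivergence]
  simp only [add_apply, smul_apply, smul_eq_mul,
    hG.fderivWithin_formNorm_rpow_self (hs z hz) hz hX]
  ring

/-- The `p`-Bochner identity for a vector field `X` with self-adjoint covariant derivative: `V`
plays the role of `∇|∇u|^p`, and the weighted divergence that of `Δ_p u`. -/
theorem IsMetricAt.pBochner_of_selfAdjoint (hG : IsMetricAt G s z)
    (hs : UniqueDiffOn ℝ s) (hz : z ∈ s) (hX : IsSelfAdjointFieldAt G s X z)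
    (hX₂ : TwiceDifferentiableWithinAt X s z)
    (hX_symm₂ : IsSymmSndFDerivWithinAt ℝ X s z) {p : ℝ} (hp : p ≠ 0) {V : E → E}
    (hV : V =ᶠ[𝓝[s] z] fun y ↦ formNorm (G y) (X y) ^ (p - 2) • (p • ∇[G, s] X y (X y))) :
    1 / p * (formNorm (G z) (X z) ^ (p - 2) * traceL E (∇[G, s] V z)
      + (p - 2) * formNorm (G z) (X z) ^ (p - 4) * G z (∇[G, s] V z (X z)) (X z)) =
    formNorm (G z) (X z) ^ (2 * (p - 2)) *
      (formNorm (G z) (X z) ^ (2 - p) *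
          (fderivWithin ℝ (weightedDivergence G s X (p - 2)) s z (X z)
            - (p - 2) * rayleigh G s X z * weightedDivergence G s X (p - 2) z)
        + traceL E (∇[G, s] X z ∘L ∇[G, s] X z) + p * (p - 2) * rayleigh G s X z ^ 2
        + traceL E (connCurvature (leviCivita G s) s z (X z) (X z))) := by
  have : CompleteSpace E := FiniteDimensional.complete ℝ E
  have hn : 0 < formNorm (G z) (X z) := formNorm_pos hX.pos
  have hW := hG.differentiableWithinAt_connDeriv_self hs hz hX₂
  have hpW : ∇[G, s] (fun y ↦ p • ∇[G, s] X y (X y)) z =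
      p • ∇[G, s] (fun y ↦ ∇[G, s] X y (X y)) z := by
    rw [connDeriv_smul (hs z hz) (differentiableWithinAt_const p) hW]
    ext v
    simp
  rw [connDeriv_congr hz hV, hG.connDeriv_formNorm_rpow_smul (hs z hz) hz hX
      (hW.fun_const_smul p), hpW,
    hG.fderivWithin_weightedDivergence_self_sub hs hz hX hX₂ (p - 2),
    hG.fderivWithin_rayleigh_self hs hz hX hX₂]
  simp only [map_add, map_smul, traceL_smulRight, add_apply, smul_apply, smul_eq_mul,
    ContinuousLinearMap.smulRight_apply]
  rw [traceL_connDeriv_connDeriv_self (hs z hz) hz (hG.differentiableWithinAt_leviCivita hs hz)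
    (hG.leviCivita_symm (hs z hz) hz) hX₂ hX_symm₂]
  have hpow₄ : formNorm (G z) (X z) ^ (p - 4) =
      formNorm (G z) (X z) ^ (p - 2) / formNorm (G z) (X z) ^ 2 := by
    rw [← Real.rpow_two, ← Real.rpow_sub hn]
    ring_nf
  have hpow_neg : formNorm (G z) (X z) ^ (2 - p) = (formNorm (G z) (X z) ^ (p - 2))⁻¹ := by
    rw [← Real.rpow_neg hn.le, neg_sub]
  have hpow_two : formNorm (G z) (X z) ^ (2 * (p - 2)) = (formNorm (G z) (X z) ^ (p - 2)) ^ 2 := by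
    rw [mul_comm, Real.rpow_mul hn.le, Real.rpow_two]
  rw [hpow₄, hpow_neg, hpow_two, rayleigh]
  have hq : formNorm (G z) (X z) ^ (p - 2) ≠ 0 := (Real.rpow_pos_of_pos hn _).ne'
  field_simp
  ring

end FieldCalculus

section LocalGradient

variable {E : Type*} [NormedAddCommGroup E] [NormedSpace ℝ E]

/-- The gradient of `u` with respect to the metric `G` on `s`. -/
def localGrad (G : E → E →L[ℝ] E →L[ℝ] ℝ) (s : Set E) (u : E → ℝ) (z : E) : E :=
  (G z).inverse (fderivWithin ℝ u s z)

variable {G : E → E →L[ℝ] E →L[ℝ] ℝ} {s : Set E} {z : E} {u : E → ℝ}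

theorem metric_localGrad (hG : (G z).IsInvertible) :
    G z (localGrad G s u z) = fderivWithin ℝ u s z :=
  hG.self_apply_inverse _

theorem IsMetricAt.localGrad_formNorm_rpow (hG : IsMetricAt G s z)
    (hs : UniqueDiffWithinAt ℝ s z) (hz : z ∈ s) {X : E → E} (hX : IsSelfAdjointFieldAt G s X z)
    (r : ℝ) :
    localGrad G s (fun y ↦ formNorm (G y) (X y) ^ r) z =
      formNorm (G z) (X z) ^ (r - 2) • (r • ∇[G, s] X z (X z)) := by
  rw [localGrad, (hG.hasFDerivWithinAt_formNorm_rpow hs hz hX r).fderivWithin hs,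
    map_smul, (hG.isInvertible.self_of_nhdsWithin hz).inverse_apply_self, smul_smul, mul_comm]

variable [CompleteSpace E]

theorem IsMetricAt.differentiableWithinAt_localGrad (hG : IsMetricAt G s z) (hz : z ∈ s)
    (hu : DifferentiableWithinAt ℝ (fderivWithin ℝ u s) s z) :
    DifferentiableWithinAt ℝ (localGrad G s u) s z :=
  (hG.differentiableWithinAt_inverse hz).clm_apply hu

theorem IsMetricAt.metric_fderivWithin_localGrad (hG : IsMetricAt G s z)
    (hs : UniqueDiffWithinAt ℝ s z) (hz : z ∈ s)
    (hu : DifferentiableWithinAt ℝ (fderivWithin ℝ u s) s z) :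
    G z ∘L fderivWithin ℝ (localGrad G s u) s z =
      fderivWithin ℝ (fderivWithin ℝ u s) s z
        - (fderivWithin ℝ G s z).flip (localGrad G s u z) := by
  have hderiv := (hG.differentiableWithinAt.hasFDerivWithinAt.clm_apply
    (hG.differentiableWithinAt_localGrad hz hu).hasFDerivWithinAt).congr_of_eventuallyEq
    (f₁ := fderivWithin ℝ u s) (hG.isInvertible.mono fun y hy ↦ (metric_localGrad hy).symm)
    (metric_localGrad (hG.isInvertible.self_of_nhdsWithin hz)).symm
  rw [hderiv.fderivWithin hs, add_sub_cancel_right]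

theorem IsMetricAt.metric_connDeriv_localGrad (hG : IsMetricAt G s z)
    (hs : UniqueDiffWithinAt ℝ s z) (hz : z ∈ s)
    (hu : DifferentiableWithinAt ℝ (fderivWithin ℝ u s) s z) (v w : E) :
    G z (∇[G, s] (localGrad G s u) z v) w =
      fderivWithin ℝ (fderivWithin ℝ u s) s z v w
        - fderivWithin ℝ u s z (leviCivita G s z v w) := by
  have hderiv := DFunLike.congr_fun (DFunLike.congr_fun
    (hG.metric_fderivWithin_localGrad hs hz hu) v) w
  simp only [ContinuousLinearMap.comp_apply, sub_apply, ContinuousLinearMap.flip_apply,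
    hG.fderivWithin_apply hs hz] at hderiv
  rw [connDeriv_apply, map_add, add_apply, hderiv,
    ← metric_localGrad (hG.isInvertible.self_of_nhdsWithin hz)]
  ring

theorem IsMetricAt.connDeriv_localGrad_symm (hG : IsMetricAt G s z)
    (hs : UniqueDiffWithinAt ℝ s z) (hz : z ∈ s)
    (hu : DifferentiableWithinAt ℝ (fderivWithin ℝ u s) s z)
    (hu_symm : IsSymmSndFDerivWithinAt ℝ u s z) (v w : E) :
    G z (∇[G, s] (localGrad G s u) z v) w = G z (∇[G, s] (localGrad G s u) z w) v := by
  rw [hG.metric_connDeriv_localGrad hs hz hu, hG.metric_connDeriv_localGrad hs hz hu,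
    hG.leviCivita_symm hs hz, hu_symm.eq]

theorem IsMetricAt.twiceDifferentiableWithinAt_localGrad (hG : IsMetricAt G s z)
    (hs : UniqueDiffOn ℝ s) (hz : z ∈ s) (hu : ContDiffWithinAt ℝ 2 u s z)
    (hu₃ : DifferentiableWithinAt ℝ (fderivWithin ℝ (fderivWithin ℝ u s) s) s z) :
    TwiceDifferentiableWithinAt (localGrad G s u) s z := by
  have hnear : ∀ᶠ y in 𝓝[s] z, y ∈ s ∧ IsMetricAt G s y ∧
      DifferentiableWithinAt ℝ (fderivWithin ℝ u s) s y := by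
    filter_upwards [self_mem_nhdsWithin, hG.eventually hz, eventually_contDiffWithinAt_two hz hu]
      with y hy hGy huy
    exact ⟨hy, hGy, (twiceDifferentiableWithinAt_of_contDiffWithinAt hs hy huy).fderivWithin⟩
  have hformula : fderivWithin ℝ (localGrad G s u) s =ᶠ[𝓝[s] z] fun y ↦ (G y).inverse ∘L
      (fderivWithin ℝ (fderivWithin ℝ u s) s y
        - (fderivWithin ℝ G s y).flip (localGrad G s u y)) := by
    filter_upwards [hnear] with y ⟨hy, hGy, huy⟩
    rw [← hGy.metric_fderivWithin_localGrad (hs y hy) hy huy]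
    ext v
    simp [(hGy.isInvertible.self_of_nhdsWithin hy).inverse_apply_self]
  have hflip : DifferentiableWithinAt ℝ (fun y ↦ (fderivWithin ℝ G s y).flip) s z :=
    (hasFDerivWithinAt_clm_flip (twiceDifferentiableWithinAt_of_contDiffWithinAt hs hz
      hG.contDiff).fderivWithin.hasFDerivWithinAt).differentiableWithinAt
  have hgrad := hG.differentiableWithinAt_localGrad hz (hnear.self_of_nhdsWithin hz).2.2
  refine ⟨hnear.mono fun y hy ↦ hy.2.1.differentiableWithinAt_localGrad hy.1 hy.2.2, ?_⟩
  exact ((hG.differentiableWithinAt_inverse hz).clm_comp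
    (hu₃.fun_sub (hflip.clm_apply hgrad))).congr_of_eventuallyEq hformula
    (hformula.self_of_nhdsWithin hz)

theorem IsMetricAt.eventually_isSelfAdjointFieldAt_localGrad (hG : IsMetricAt G s z)
    (hs : Convex ℝ s) (hne : (interior s).Nonempty) (hz : z ∈ s) (hu : ContDiffWithinAt ℝ 2 u s z)
    (hpos : 0 < G z (localGrad G s u z) (localGrad G s u z)) :
    ∀ᶠ y in 𝓝[s] z, y ∈ s ∧ IsMetricAt G s y ∧ IsSelfAdjointFieldAt G s (localGrad G s u) y := by
  have hs_unique := uniqueDiffOn_convex hs hne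
  have hu_near : ∀ᶠ y in 𝓝[s] z, y ∈ s → TwiceDifferentiableWithinAt u s y :=
    (eventually_contDiffWithinAt_two hz hu).mono fun y huy hy ↦
      twiceDifferentiableWithinAt_of_contDiffWithinAt hs_unique hy huy
  have hgrad := hG.differentiableWithinAt_localGrad hz
    (hu_near.self_of_nhdsWithin hz hz).fderivWithin
  have hpos_near : ∀ᶠ y in 𝓝[s] z, 0 < G y (localGrad G s u y) (localGrad G s u y) :=
    ((hG.differentiableWithinAt.clm_apply hgrad).clm_apply
      hgrad).continuousWithinAt.eventually_const_lt hpos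
  filter_upwards [self_mem_nhdsWithin, hG.eventually hz, hu_near, hpos_near] with y hy hGy huy hpy
  exact ⟨hy, hGy, hGy.differentiableWithinAt_localGrad hy (huy hy).fderivWithin,
    hGy.connDeriv_localGrad_symm (hs_unique y hy) hy (huy hy).fderivWithin
      ((huy hy).isSymmSndFDerivWithinAt hs hne hy), hpy⟩

end LocalGradient

section LocalBochner

variable {E : Type*} [NormedAddCommGroup E] [NormedSpace ℝ E] [FiniteDimensional ℝ E]

/-- The `p`-Laplacian of `u` with respect to the metric `G` on `s`. -/
def localPLaplacian (G : E → E →L[ℝ] E →L[ℝ] ℝ) (s : Set E) (p : ℝ) (u : E → ℝ) (z : E) : ℝ :=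
  traceL E (∇[G, s] (fun y ↦
    formNorm (G y) (localGrad G s u y) ^ (p - 2) • localGrad G s u y) z)

variable {G : E → E →L[ℝ] E →L[ℝ] ℝ} {s : Set E} {z : E} {u : E → ℝ}

theorem IsMetricAt.localPLaplacian_eventuallyEq (hG : IsMetricAt G s z) (hs : Convex ℝ s)
    (hne : (interior s).Nonempty) (hz : z ∈ s) (hu : ContDiffWithinAt ℝ 2 u s z)
    (hpos : 0 < G z (localGrad G s u z) (localGrad G s u z)) (p : ℝ) :
    localPLaplacian G s p u =ᶠ[𝓝[s] z] weightedDivergence G s (localGrad G s u) (p - 2) :=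
  have : CompleteSpace E := FiniteDimensional.complete ℝ E
  (hG.eventually_isSelfAdjointFieldAt_localGrad hs hne hz hu hpos).mono fun y ⟨hy, hGy, hgrad⟩ ↦
    hGy.traceL_connDeriv_formNorm_rpow_smul_self (uniqueDiffOn_convex hs hne y hy) hy hgrad (p - 2)

theorem IsMetricAt.differentiableWithinAt_localPLaplacian (hG : IsMetricAt G s z)
    (hs : Convex ℝ s) (hne : (interior s).Nonempty) (hz : z ∈ s) (hu : ContDiffWithinAt ℝ 2 u s z)
    (hu₃ : DifferentiableWithinAt ℝ (fderivWithin ℝ (fderivWithin ℝ u s) s) s z)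
    (hpos : 0 < G z (localGrad G s u z) (localGrad G s u z)) (p : ℝ) :
    DifferentiableWithinAt ℝ (localPLaplacian G s p u) s z := by
  have : CompleteSpace E := FiniteDimensional.complete ℝ E
  have hs_unique := uniqueDiffOn_convex hs hne
  obtain ⟨-, -, hgrad⟩ := (hG.eventually_isSelfAdjointFieldAt_localGrad hs hne hz hu
    hpos).self_of_nhdsWithin hz
  have hL := hG.localPLaplacian_eventuallyEq hs hne hz hu hpos p
  exact (hG.hasFDerivWithinAt_weightedDivergence hs_unique hz hgrad
    (hG.twiceDifferentiableWithinAt_localGrad hs_unique hz hu hu₃)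
    (p - 2)).differentiableWithinAt.congr_of_eventuallyEq hL (hL.self_of_nhdsWithin hz)

theorem IsMetricAt.pBochner_localGrad (hG : IsMetricAt G s z) (hs : Convex ℝ s)
    (hne : (interior s).Nonempty) (hz : z ∈ s) (hu : ContDiffWithinAt ℝ 2 u s z)
    (hu₃ : DifferentiableWithinAt ℝ (fderivWithin ℝ (fderivWithin ℝ u s) s) s z)
    {X V : E → E} (hX : X = localGrad G s u) (hpos : 0 < G z (X z) (X z)) {p : ℝ} (hp : p ≠ 0)
    (hV : V = localGrad G s fun y ↦ formNorm (G y) (X y) ^ p) :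
    1 / p * (formNorm (G z) (X z) ^ (p - 2) * traceL E (∇[G, s] V z)
      + (p - 2) * formNorm (G z) (X z) ^ (p - 4) * G z (∇[G, s] V z (X z)) (X z)) =
    formNorm (G z) (X z) ^ (2 * (p - 2)) *
      (formNorm (G z) (X z) ^ (2 - p) *
          (fderivWithin ℝ (localPLaplacian G s p u) s z (X z)
            - (p - 2) * rayleigh G s X z * localPLaplacian G s p u z)
        + traceL E (∇[G, s] X z ∘L ∇[G, s] X z) + p * (p - 2) * rayleigh G s X z ^ 2
        + traceL E (connCurvature (leviCivita G s) s z (X z) (X z))) := by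
  subst hX hV
  have : CompleteSpace E := FiniteDimensional.complete ℝ E
  have hs_unique := uniqueDiffOn_convex hs hne
  have hX_near := hG.eventually_isSelfAdjointFieldAt_localGrad hs hne hz hu hpos
  have hX₂ := hG.twiceDifferentiableWithinAt_localGrad hs_unique hz hu hu₃
  have hL := hG.localPLaplacian_eventuallyEq hs hne hz hu hpos p
  rw [hL.fderivWithin_eq_of_mem hz, hL.self_of_nhdsWithin hz]
  refine hG.pBochner_of_selfAdjoint hs_unique hz (hX_near.self_of_nhdsWithin hz).2.2 hX₂
    (hX₂.isSymmSndFDerivWithinAt hs hne hz) hp ?_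
  exact hX_near.mono fun y ⟨hy, hGy, hXy⟩ ↦
    hGy.localGrad_formNorm_rpow (hs_unique y hy) hy hXy p

end LocalBochner

section ChartDerivative

variable {E : Type*} [NormedAddCommGroup E] [NormedSpace ℝ E]
  {H : Type*} [TopologicalSpace H] (I : ModelWithCorners ℝ E H)
  {M : Type*} [TopologicalSpace M] [ChartedSpace H M]

/-- The derivative of the inverse of the chart at `x`. The tangent spaces of `M` are read as the
model space, so that these maps can be composed for different charts. -/
def chartInvDeriv (x : M) (z : E) : E →L[ℝ] E :=
  mfderivWithin 𝓘(ℝ, E) I (extChartAt I x).symm (range I) z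

/-- The representative of the vector field `X` in the chart at `x`. -/
def chartField (X : ∀ y : M, TangentSpace I y) (x : M) : E → E :=
  VectorField.mpullbackWithin 𝓘(ℝ, E) I (extChartAt I x).symm X (range I)

/-- The change of coordinates from the chart at `y` to the chart at `x`. -/
def coordChange (x y : M) : E → E := extChartAt I x ∘ (extChartAt I y).symm

variable {x y : M} {z : E}

theorem chartField_smul (f : M → ℝ) (X : ∀ y : M, TangentSpace I y) (x : M) (z : E) :
    chartField I (fun y ↦ f y • X y) x z =
      f ((extChartAt I x).symm z) • chartField I X x z :=
  map_smul (chartInvDeriv I x z).inverse _ _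

theorem coordChange_self (x y : M) : coordChange I x y (extChartAt I y y) = extChartAt I x y := by
  rw [coordChange, Function.comp_apply, extChartAt_to_inv]

theorem eventually_mem_target_and_extChartAt_symm {P : M → Prop} (hP : ∀ᶠ y in 𝓝 x, P y) :
    ∀ᶠ z in 𝓝[range I] (extChartAt I x x),
      z ∈ (extChartAt I x).target ∧ P ((extChartAt I x).symm z) := by
  refine Filter.Eventually.and (extChartAt_target_mem_nhdsWithin x) ?_
  refine (continuousAt_extChartAt_symm x).continuousWithinAt.eventually ?_
  rwa [extChartAt_to_inv]

theorem eventually_mem_source_coordChange (hy : y ∈ (extChartAt I x).source) :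
    ∀ᶠ z in 𝓝[range I] (extChartAt I y y), z ∈ (extChartAt I y).target ∧
      (extChartAt I y).symm z ∈ (extChartAt I x).source :=
  eventually_mem_target_and_extChartAt_symm I (extChartAt_source_mem_nhds' hy)

variable [IsManifold I 1 M]

theorem isInvertible_chartInvDeriv (hz : z ∈ (extChartAt I x).target) :
    (chartInvDeriv I x z).IsInvertible :=
  isInvertible_mfderivWithin_extChartAt_symm hz

theorem chartInvDeriv_self (x : M) :
    chartInvDeriv I x (extChartAt I x x) = ContinuousLinearMap.id ℝ E :=
  mfderivWithin_range_extChartAt_symm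

theorem chartInvDeriv_chartField (X : ∀ y : M, TangentSpace I y)
    (hz : z ∈ (extChartAt I x).target) :
    chartInvDeriv I x z (chartField I X x z) = X ((extChartAt I x).symm z) :=
  (isInvertible_chartInvDeriv I hz).self_apply_inverse _

theorem chartField_self (X : ∀ y : M, TangentSpace I y) (x : M) :
    chartField I X x (extChartAt I x x) = X x := by
  have h := chartInvDeriv_chartField I X (mem_extChartAt_target x)
  rwa [chartInvDeriv_self, extChartAt_to_inv] at h

theorem chartInvDeriv_comp_fderivWithin_coordChange (hz : z ∈ (extChartAt I y).target)
    (hzx : (extChartAt I y).symm z ∈ (extChartAt I x).source) :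
    chartInvDeriv I x (coordChange I x y z) ∘L fderivWithin ℝ (coordChange I x y) (range I) z =
      chartInvDeriv I y z := by
  have hchain : fderivWithin ℝ (coordChange I x y) (range I) z =
      mfderiv I 𝓘(ℝ, E) (extChartAt I x) ((extChartAt I y).symm z) ∘L
        mfderivWithin 𝓘(ℝ, E) I (extChartAt I y).symm (range I) z := by
    rw [← mfderivWithin_eq_fderivWithin, coordChange, mfderiv_comp_mfderivWithin (I' := I)]
    · exact mdifferentiableAt_extChartAt (by rwa [← extChartAt_source I])
    · exact mdifferentiableWithinAt_extChartAt_symm hz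
    · exact I.uniqueMDiffOn _ (extChartAt_target_subset_range y hz)
  ext v
  rw [hchain]
  exact DFunLike.congr_fun (mfderivWithin_extChartAt_symm_comp_mfderiv_extChartAt' (I := I) hzx)
    (chartInvDeriv I y z v)

theorem isInvertible_fderivWithin_coordChange (hz : z ∈ (extChartAt I y).target)
    (hzx : (extChartAt I y).symm z ∈ (extChartAt I x).source) :
    (fderivWithin ℝ (coordChange I x y) (range I) z).IsInvertible := by
  have hx : (chartInvDeriv I x (coordChange I x y z)).IsInvertible :=
    isInvertible_chartInvDeriv I ((extChartAt I x).map_source hzx)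
  have h := hx.inverse.comp (isInvertible_chartInvDeriv I hz)
  rwa [← chartInvDeriv_comp_fderivWithin_coordChange I hz hzx, ← ContinuousLinearMap.comp_assoc,
    hx.inverse_comp_self, ContinuousLinearMap.id_comp] at h

theorem fderivWithin_coordChange_chartField (X : ∀ y : M, TangentSpace I y)
    (hz : z ∈ (extChartAt I y).target)
    (hzx : (extChartAt I y).symm z ∈ (extChartAt I x).source) :
    fderivWithin ℝ (coordChange I x y) (range I) z (chartField I X y z) =
      chartField I X x (coordChange I x y z) := by
  have hxz : coordChange I x y z ∈ (extChartAt I x).target := (extChartAt I x).map_source hzx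
  apply (isInvertible_chartInvDeriv I hxz).injective
  rw [chartInvDeriv_chartField I X hxz, coordChange, Function.comp_apply,
    (extChartAt I x).left_inv hzx, ← chartInvDeriv_chartField I X hz,
    ← chartInvDeriv_comp_fderivWithin_coordChange I hz hzx]
  rfl

theorem fderivWithin_comp_extChartAt_symm {u : M → ℝ} (hz : z ∈ (extChartAt I x).target)
    (hu : MDifferentiableAt I 𝓘(ℝ, ℝ) u ((extChartAt I x).symm z)) (w : E) :
    fderivWithin ℝ (u ∘ (extChartAt I x).symm) (range I) z w =
      mfderiv I 𝓘(ℝ, ℝ) u ((extChartAt I x).symm z) (chartInvDeriv I x z w) := by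
  rw [← mfderivWithin_eq_fderivWithin, mfderiv_comp_mfderivWithin (I' := I) _ hu
    (mdifferentiableWithinAt_extChartAt_symm hz)
    (I.uniqueMDiffOn _ (extChartAt_target_subset_range x hz))]
  rfl

theorem mdifferentiableAt_of_comp_extChartAt_symm {f : M → ℝ}
    (hy : y ∈ (extChartAt I x).source)
    (hf : DifferentiableWithinAt ℝ (f ∘ (extChartAt I x).symm) (range I) (extChartAt I x y)) :
    MDifferentiableAt I 𝓘(ℝ, ℝ) f y := by
  have hcomp : MDifferentiableAt I 𝓘(ℝ, ℝ) ((f ∘ (extChartAt I x).symm) ∘ extChartAt I x) y := by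
    rw [← mdifferentiableWithinAt_univ]
    exact MDifferentiableWithinAt.comp (I' := 𝓘(ℝ, E)) (u := range I) y
      hf.mdifferentiableWithinAt
      (mdifferentiableAt_extChartAt (by rwa [← extChartAt_source I])).mdifferentiableWithinAt
      fun a _ ↦ mem_range_self _
  refine hcomp.congr_of_eventuallyEq ?_
  filter_upwards [extChartAt_source_mem_nhds' hy] with a ha
  rw [Function.comp_apply, Function.comp_apply, (extChartAt I x).left_inv ha]

theorem contMDiffOn_chartInvDeriv (n : WithTop ℕ∞) [IsManifold I (n + 1) M] (x : M) (v : E) :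
    ContMDiffOn 𝓘(ℝ, E) I.tangent n
      (fun z ↦ (⟨(extChartAt I x).symm z, chartInvDeriv I x z v⟩ : TangentBundle I M))
      (extChartAt I x).target := by
  have hunique : UniqueMDiffOn 𝓘(ℝ, E) (extChartAt I x).target :=
    uniqueMDiffOn_iff_uniqueDiffOn.2 (uniqueDiffOn_extChartAt_target x)
  have htangent := (contMDiffOn_extChartAt_symm (I := I) (n := n + 1)
    x).contMDiffOn_tangentMapWithin (m := n) le_rfl hunique
  have hconst : ContMDiffOn 𝓘(ℝ, E) 𝓘(ℝ, E).tangent n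
      (fun z ↦ (⟨z, v⟩ : TangentBundle 𝓘(ℝ, E) E)) (extChartAt I x).target :=
    contMDiffOn_vectorSpace_iff_contDiffOn.2 contDiffOn_const
  refine (htangent.comp hconst fun z hz ↦ hz).congr fun z hz ↦ ?_
  have hmono : mfderivWithin 𝓘(ℝ, E) I (extChartAt I x).symm (extChartAt I x).target z =
      chartInvDeriv I x z :=
    (mdifferentiableWithinAt_extChartAt_symm hz).mfderivWithin_mono (hunique z hz)
      (extChartAt_target_subset_range x)
  exact congrArg (fun A : E →L[ℝ] E ↦ (⟨(extChartAt I x).symm z, A v⟩ : TangentBundle I M))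
    hmono.symm

end ChartDerivative

section ChartMetric

theorem isInvertible_of_apply_self_ne_zero {E : Type*} [NormedAddCommGroup E] [NormedSpace ℝ E]
    [FiniteDimensional ℝ E] {B : E →L[ℝ] E →L[ℝ] ℝ} (hB : ∀ v, B v v = 0 → v = 0) :
    B.IsInvertible := by
  have hinj : Function.Injective (B : E →ₗ[ℝ] E →L[ℝ] ℝ) :=
    (injective_iff_map_eq_zero _).2 fun v hv ↦ hB v (DFunLike.congr_fun hv v)
  have hdim : Module.finrank ℝ E = Module.finrank ℝ (E →L[ℝ] ℝ) := by
    rw [← (LinearMap.toContinuousLinearMap (𝕜 := ℝ) (E := E) (F' := ℝ)).finrank_eq]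
    exact Subspace.dual_finrank_eq.symm
  exact ⟨(LinearEquiv.ofInjectiveOfFinrankEq _ hinj hdim).toContinuousLinearEquiv, rfl⟩

variable {E : Type*} [NormedAddCommGroup E] [NormedSpace ℝ E]
  {H : Type*} [TopologicalSpace H] (I : ModelWithCorners ℝ E H)
  {M : Type*} [TopologicalSpace M] [ChartedSpace H M]
  [RiemannianBundle (fun x : M ↦ TangentSpace I x)]

/-- The scalar product of the tangent space at `y`, read in the model space. -/
def tangentInner (y : M) : E →L[ℝ] E →L[ℝ] ℝ := innerSL ℝ (E := TangentSpace I y)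

theorem formNorm_tangentInner (y : M) (v : TangentSpace I y) :
    formNorm (tangentInner I y) v = ‖v‖ :=
  (norm_eq_sqrt_real_inner v).symm

theorem tangentInner_symm (y : M) (v w : E) : tangentInner I y v w = tangentInner I y w v :=
  real_inner_comm (F := TangentSpace I y) w v

theorem chartMetric_apply (x : M) (z v w : E) : chartMetric I x z v w =
    tangentInner I ((extChartAt I x).symm z) (chartInvDeriv I x z v) (chartInvDeriv I x z w) := rfl

theorem covDeriv_eq_connDeriv (X : ∀ y : M, TangentSpace I y) (x : M) (v : E) :
    covDeriv I X x v =
      ∇[chartMetric I x, range I] (chartField I X x) (extChartAt I x x) v := by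
  rw [connDeriv_apply, leviCivita_apply]
  rfl

variable {x y : M} {z : E}

section

variable [IsManifold I 1 M]

theorem chartMetric_self (x : M) : chartMetric I x (extChartAt I x x) = tangentInner I x := by
  ext v w
  rw [chartMetric_apply, chartInvDeriv_self, extChartAt_to_inv]
  rfl

theorem formNorm_chartMetric_chartField (X : ∀ y : M, TangentSpace I y)
    (hz : z ∈ (extChartAt I x).target) :
    formNorm (chartMetric I x z) (chartField I X x z) = ‖X ((extChartAt I x).symm z)‖ := by
  rw [formNorm, chartMetric_apply, chartInvDeriv_chartField I X hz]
  exact formNorm_tangentInner I _ _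

theorem chartMetric_coordChange (hz : z ∈ (extChartAt I y).target)
    (hzx : (extChartAt I y).symm z ∈ (extChartAt I x).source) (v w : E) :
    chartMetric I y z v w = chartMetric I x (coordChange I x y z)
      (fderivWithin ℝ (coordChange I x y) (range I) z v)
      (fderivWithin ℝ (coordChange I x y) (range I) z w) := by
  rw [chartMetric_apply, chartMetric_apply,
    ← chartInvDeriv_comp_fderivWithin_coordChange I hz hzx, coordChange, Function.comp_apply,
    (extChartAt I x).left_inv hzx]
  rfl

theorem isInvertible_chartMetric [FiniteDimensional ℝ E] (hz : z ∈ (extChartAt I x).target) :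
    (chartMetric I x z).IsInvertible := by
  refine isInvertible_of_apply_self_ne_zero fun v hv ↦ ?_
  have hTv : chartInvDeriv I x z v = 0 :=
    inner_self_eq_zero (𝕜 := ℝ) (E := TangentSpace I ((extChartAt I x).symm z)).1 hv
  exact (isInvertible_chartInvDeriv I hz).injective (hTv.trans (map_zero _).symm)

theorem contDiffOn_chartMetric [FiniteDimensional ℝ E] (n : WithTop ℕ∞) [IsManifold I (n + 1) M]
    [IsContMDiffRiemannianBundle I n E (fun x : M ↦ TangentSpace I x)] (x : M) :
    ContDiffOn ℝ n (chartMetric I x) (extChartAt I x).target := by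
  simp only [contDiffOn_clm_apply]
  intro v w
  exact contMDiffOn_iff_contDiffOn.1 <| ContMDiffOn.inner_bundle
    (E := fun y : M ↦ TangentSpace I y) (IB := I) (F := E) (b := (extChartAt I x).symm)
    (v := fun z ↦ chartInvDeriv I x z v) (w := fun z ↦ chartInvDeriv I x z w)
    (contMDiffOn_chartInvDeriv I n x v) (contMDiffOn_chartInvDeriv I n x w)

end

theorem isLocalIsometryAt_coordChange [IsManifold I 2 M] (hy : y ∈ (extChartAt I x).source) :
    IsLocalIsometryAt (coordChange I x y) (chartMetric I y) (chartMetric I x) (range I) (range I)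
      (extChartAt I y y) where
  contDiff := contDiffWithinAt_ext_coord_change x y (by simpa [PartialEquiv.trans_source] using hy)
  mapsTo := .of_forall fun z ↦ mem_range_self _
  isInvertible := (eventually_mem_source_coordChange I hy).mono fun z hz ↦
    isInvertible_fderivWithin_coordChange I hz.1 hz.2
  pullback := (eventually_mem_source_coordChange I hy).mono fun z hz ↦
    chartMetric_coordChange I hz.1 hz.2

theorem isMetricAt_chartMetric [FiniteDimensional ℝ E] [IsManifold I 3 M]
    [IsContMDiffRiemannianBundle I 2 E (fun x : M ↦ TangentSpace I x)]
    (hz : z ∈ (extChartAt I x).target) : IsMetricAt (chartMetric I x) (range I) z where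
  contDiff :=
    have : IsManifold I (2 + 1) M := by rwa [two_add_one_eq_three]
    (contDiffOn_chartMetric I 2 x z hz).mono_of_mem_nhdsWithin
      (extChartAt_target_mem_nhdsWithin_of_mem hz)
  symm := .of_forall fun y v w ↦ by
    rw [chartMetric_apply, tangentInner_symm, chartMetric_apply]
  isInvertible := by
    filter_upwards [extChartAt_target_mem_nhdsWithin_of_mem hz] with y hy
      using isInvertible_chartMetric I hy

end ChartMetric

section Operators

variable {E : Type*} [NormedAddCommGroup E] [NormedSpace ℝ E] [FiniteDimensional ℝ E]
  {H : Type*} [TopologicalSpace H] (I : ModelWithCorners ℝ E H)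
  {M : Type*} [TopologicalSpace M] [ChartedSpace H M]
  [RiemannianBundle (fun x : M ↦ TangentSpace I x)]

/-- An orthonormal basis of the tangent space at `x`, read in the model space. -/
def tangentBasis (x : M) (i : Fin (Module.finrank ℝ (TangentSpace I x))) : E :=
  stdOrthonormalBasis ℝ (TangentSpace I x) i

theorem sum_tangentInner_eq_traceL (x : M) (A : E →L[ℝ] E) :
    ∑ i, tangentInner I x (A (tangentBasis I x i)) (tangentBasis I x i) = traceL E A := by
  simp only [tangentInner_symm I x (A _)]
  let A' : TangentSpace I x →ₗ[ℝ] TangentSpace I x := (A : E →ₗ[ℝ] E)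
  exact (LinearMap.trace_eq_sum_inner A' (stdOrthonormalBasis ℝ (TangentSpace I x))).symm

theorem sum_tangentInner_sq_eq_traceL (x : M) {A : E →L[ℝ] E}
    (hA : ∀ v w, tangentInner I x (A v) w = tangentInner I x (A w) v) :
    ∑ i, ∑ j, tangentInner I x (A (tangentBasis I x i)) (tangentBasis I x j) ^ 2 =
      traceL E (A ∘L A) := by
  rw [← sum_tangentInner_eq_traceL I x]
  refine Finset.sum_congr rfl fun i _ ↦ ?_
  rw [ContinuousLinearMap.comp_apply, hA]
  exact ((stdOrthonormalBasis ℝ (TangentSpace I x)).sum_sq_inner_left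
    (A (tangentBasis I x i))).trans (real_inner_self_eq_norm_sq (F := TangentSpace I x) _).symm

theorem tangentInner_grad (u : M → ℝ) (x : M) :
    tangentInner I x (grad I u x) = mfderiv I 𝓘(ℝ, ℝ) u x := by
  have : CompleteSpace (TangentSpace I x) := FiniteDimensional.complete ℝ _
  ext w
  exact InnerProductSpace.toDual_symm_apply (E := TangentSpace I x)

theorem divergence_eq_traceL (X : ∀ y : M, TangentSpace I y) (x : M) :
    divergence I X x =
      traceL E (∇[chartMetric I x, range I] (chartField I X x) (extChartAt I x x)) := by
  rw [← sum_tangentInner_eq_traceL I x]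
  simp only [← covDeriv_eq_connDeriv]
  rfl

variable {x y : M} {z : E}

theorem divergence_eq_traceL_of_mem_source [IsManifold I 3 M]
    [IsContMDiffRiemannianBundle I 2 E (fun x : M ↦ TangentSpace I x)]
    {X : ∀ y : M, TangentSpace I y} (hy : y ∈ (extChartAt I x).source)
    (hX : DifferentiableWithinAt ℝ (chartField I X x) (range I) (extChartAt I x y)) :
    divergence I X y =
      traceL E (∇[chartMetric I x, range I] (chartField I X x) (extChartAt I x y)) := by
  have hψ := isLocalIsometryAt_coordChange I hy
  have hψ_symm := (twiceDifferentiableWithinAt_of_contDiffWithinAt I.uniqueDiffOn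
    (mem_range_self _) hψ.contDiff).isSymmSndFDerivWithinAt I.convex_range I.nonempty_interior
    (mem_range_self _)
  rw [divergence_eq_traceL, ← coordChange_self I x y]
  rw [← coordChange_self I x y] at hX
  refine hψ.traceL_connDeriv I.uniqueDiffOn I.uniqueDiffOn (mem_range_self _) hψ_symm ?_
    (isInvertible_chartMetric I (mem_extChartAt_target y)) hX
    ((eventually_mem_source_coordChange I hy).mono fun z hz ↦
      fderivWithin_coordChange_chartField I X hz.1 hz.2)
  rw [coordChange_self]
  exact isMetricAt_chartMetric I ((extChartAt I x).map_source hy)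

theorem ricci_eq_traceL [IsManifold I 3 M]
    [IsContMDiffRiemannianBundle I 2 E (fun x : M ↦ TangentSpace I x)] (x : M) (v w : E) :
    ricci I x v w = traceL E (connCurvature (leviCivita (chartMetric I x) (range I)) (range I)
      (extChartAt I x x) v w) := by
  have : CompleteSpace E := FiniteDimensional.complete ℝ E
  rw [← sum_tangentInner_eq_traceL I x]
  simp only [(isMetricAt_chartMetric I (mem_extChartAt_target x)).connCurvature_leviCivita_apply
    I.uniqueDiffOn (mem_range_self _)]
  rfl

theorem connDeriv_chartField_grad {u : M → ℝ} {X : E → E}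
    (hX : chartField I (grad I u) x =ᶠ[𝓝[range I] (extChartAt I x x)] X) :
    ∇[chartMetric I x, range I] (chartField I (grad I u) x) (extChartAt I x x) =
      ∇[chartMetric I x, range I] X (extChartAt I x x) :=
  connDeriv_congr (mem_range_self _) hX

theorem laplacian_eq_traceL {u : M → ℝ} {X : E → E}
    (hX : chartField I (grad I u) x =ᶠ[𝓝[range I] (extChartAt I x x)] X) :
    laplacian I u x = traceL E (∇[chartMetric I x, range I] X (extChartAt I x x)) := by
  rw [laplacian, divergence_eq_traceL, connDeriv_chartField_grad I hX]

variable [IsManifold I 1 M]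

theorem chartField_grad {f : M → ℝ} {g : E → ℝ} (hz : z ∈ (extChartAt I x).target)
    (hfg : f ∘ (extChartAt I x).symm =ᶠ[𝓝[range I] z] g)
    (hg : DifferentiableWithinAt ℝ g (range I) z) :
    chartField I (grad I f) x z = localGrad (chartMetric I x) (range I) g z := by
  have hz_range : z ∈ range I := extChartAt_target_subset_range x hz
  have hf : MDifferentiableAt I 𝓘(ℝ, ℝ) f ((extChartAt I x).symm z) := by
    refine mdifferentiableAt_of_comp_extChartAt_symm I ((extChartAt I x).map_target hz) ?_
    rw [(extChartAt I x).right_inv hz]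
    exact hg.congr_of_eventuallyEq hfg (hfg.self_of_nhdsWithin hz_range)
  have hG := isInvertible_chartMetric I hz
  apply hG.injective
  ext w
  rw [metric_localGrad hG, chartMetric_apply, chartInvDeriv_chartField I _ hz,
    ← hfg.fderivWithin_eq_of_mem hz_range, fderivWithin_comp_extChartAt_symm I hz hf]
  exact DFunLike.congr_fun (tangentInner_grad I f _) _

theorem tangentInner_grad_of_eventuallyEq {f : M → ℝ} {g : E → ℝ}
    (hfg : f ∘ (extChartAt I x).symm =ᶠ[𝓝[range I] (extChartAt I x x)] g)
    (hg : DifferentiableWithinAt ℝ g (range I) (extChartAt I x x)) :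
    tangentInner I x (grad I f x) = fderivWithin ℝ g (range I) (extChartAt I x x) := by
  have hx := mem_extChartAt_target (I := I) x
  rw [← metric_localGrad (isInvertible_chartMetric I hx), ← chartField_grad I hx hfg hg,
    chartField_self, chartMetric_self]

section ChartRepresentative

variable {u : M → ℝ} {X : E → E}
  (hX : chartField I (grad I u) x =ᶠ[𝓝[range I] (extChartAt I x x)] X)

include hX

theorem chartRepresentative_self : X (extChartAt I x x) = grad I u x := by
  rw [← hX.self_of_nhdsWithin (mem_range_self _), chartField_self]

theorem norm_grad_eq_formNorm :
    ‖grad I u x‖ = formNorm (chartMetric I x (extChartAt I x x)) (X (extChartAt I x x)) := by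
  rw [chartRepresentative_self I hX, chartMetric_self]
  exact (formNorm_tangentInner I x _).symm

theorem hessian_eq_chartMetric (v w : E) :
    hessian I u x v w = chartMetric I x (extChartAt I x x)
      (∇[chartMetric I x, range I] X (extChartAt I x x) v) w := by
  rw [chartMetric_self, ← connDeriv_chartField_grad I hX, ← covDeriv_eq_connDeriv]
  rfl

theorem hessA_eq_rayleigh :
    hessA I u x = rayleigh (chartMetric I x) (range I) X (extChartAt I x x) := by
  rw [rayleigh, hessA, norm_grad_eq_formNorm I hX, ← hessian_eq_chartMetric I hX,
    chartRepresentative_self I hX]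

theorem linPLaplacianII_eq_traceL {η : M → ℝ} {V : E → E}
    (hV : chartField I (grad I η) x =ᶠ[𝓝[range I] (extChartAt I x x)] V) (p : ℝ) :
    linPLaplacianII I p u η x =
      formNorm (chartMetric I x (extChartAt I x x)) (X (extChartAt I x x)) ^ (p - 2) *
          traceL E (∇[chartMetric I x, range I] V (extChartAt I x x))
        + (p - 2) *
          formNorm (chartMetric I x (extChartAt I x x)) (X (extChartAt I x x)) ^ (p - 4) *
          chartMetric I x (extChartAt I x x)
            (∇[chartMetric I x, range I] V (extChartAt I x x) (X (extChartAt I x x)))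
            (X (extChartAt I x x)) := by
  rw [linPLaplacianII, laplacian_eq_traceL I hV, norm_grad_eq_formNorm I hX,
    ← hessian_eq_chartMetric I hV, chartRepresentative_self I hX]

theorem hessianNormSq_eq_traceL
    (hX_selfAdjoint : IsSelfAdjointFieldAt (chartMetric I x) (range I) X (extChartAt I x x)) :
    hessianNormSq I u x = traceL E (∇[chartMetric I x, range I] X (extChartAt I x x) ∘L
      ∇[chartMetric I x, range I] X (extChartAt I x x)) := by
  have hsymm := hX_selfAdjoint.selfAdjoint
  rw [chartMetric_self] at hsymm
  rw [← sum_tangentInner_sq_eq_traceL I x hsymm, ← connDeriv_chartField_grad I hX]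
  simp only [← covDeriv_eq_connDeriv]
  rfl

end ChartRepresentative

end Operators

section ChartGradient

variable {E : Type*} [NormedAddCommGroup E] [NormedSpace ℝ E] [FiniteDimensional ℝ E]
  {H : Type*} [TopologicalSpace H] (I : ModelWithCorners ℝ E H)
  {M : Type*} [TopologicalSpace M] [ChartedSpace H M]
  [RiemannianBundle (fun x : M ↦ TangentSpace I x)]

/-- The gradient of `u` computed in the chart at `x`. Unlike `chartField I (grad I u) x`, it does
not refer to the derivative of `u` on the manifold. -/
def chartGrad (u : M → ℝ) (x : M) : E → E :=
  localGrad (chartMetric I x) (range I) (u ∘ (extChartAt I x).symm)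

variable [IsManifold I 1 M] {u : M → ℝ} {x : M}

theorem chartField_grad_eventuallyEq (hu : ContMDiffAt I 𝓘(ℝ, ℝ) 2 u x) :
    chartField I (grad I u) x =ᶠ[𝓝[range I] (extChartAt I x x)] chartGrad I u x := by
  filter_upwards [extChartAt_target_mem_nhdsWithin x,
    eventually_contDiffWithinAt_two (mem_range_self _) (contMDiffAt_iff.1 hu).2] with z hz huz
  exact chartField_grad I hz .rfl (huz.differentiableWithinAt two_ne_zero)

theorem chartGrad_self (hu : ContMDiffAt I 𝓘(ℝ, ℝ) 2 u x) :
    chartGrad I u x (extChartAt I x x) = grad I u x :=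
  chartRepresentative_self I (chartField_grad_eventuallyEq I hu)

theorem norm_grad_eventuallyEq (hu : ContMDiffAt I 𝓘(ℝ, ℝ) 2 u x) :
    (fun z ↦ ‖grad I u ((extChartAt I x).symm z)‖) =ᶠ[𝓝[range I] (extChartAt I x x)]
      fun z ↦ formNorm (chartMetric I x z) (chartGrad I u x z) := by
  filter_upwards [extChartAt_target_mem_nhdsWithin x, chartField_grad_eventuallyEq I hu]
    with z hz hX
  rw [← hX, formNorm_chartMetric_chartField I _ hz]

theorem chartMetric_chartGrad_pos (hu : ContMDiffAt I 𝓘(ℝ, ℝ) 2 u x) (hgrad : grad I u x ≠ 0) :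
    0 < chartMetric I x (extChartAt I x x) (chartGrad I u x (extChartAt I x x))
      (chartGrad I u x (extChartAt I x x)) := by
  rw [chartGrad_self I hu, chartMetric_self]
  exact real_inner_self_pos.2 hgrad

end ChartGradient

section Bochner

variable {E : Type*} [NormedAddCommGroup E] [NormedSpace ℝ E] [FiniteDimensional ℝ E]
  {H : Type*} [TopologicalSpace H] (I : ModelWithCorners ℝ E H)
  {M : Type*} [TopologicalSpace M] [ChartedSpace H M] [IsManifold I 3 M]
  [RiemannianBundle (fun x : M ↦ TangentSpace I x)]
  [IsContMDiffRiemannianBundle I 2 E (fun x : M ↦ TangentSpace I x)]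
  {u : M → ℝ} {x : M}

theorem eventually_isSelfAdjointFieldAt_chartGrad (hu : ContMDiffAt I 𝓘(ℝ, ℝ) 2 u x)
    (hgrad : grad I u x ≠ 0) :
    ∀ᶠ z in 𝓝[range I] (extChartAt I x x), z ∈ (extChartAt I x).target ∧
      IsSelfAdjointFieldAt (chartMetric I x) (range I) (chartGrad I u x) z := by
  have : IsManifold I 1 M := .of_le (n := 3) (by norm_num)
  have : CompleteSpace E := FiniteDimensional.complete ℝ E
  filter_upwards [extChartAt_target_mem_nhdsWithin x,
    (isMetricAt_chartMetric I (mem_extChartAt_target x)).eventually_isSelfAdjointFieldAt_localGrad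
      I.convex_range I.nonempty_interior (mem_range_self _) (contMDiffAt_iff.1 hu).2
      (chartMetric_chartGrad_pos I hu hgrad)] with z hz hX
  exact ⟨hz, hX.2.2⟩

theorem chartField_grad_norm_grad_rpow_eventuallyEq (hu : ContMDiffAt I 𝓘(ℝ, ℝ) 2 u x)
    (hgrad : grad I u x ≠ 0) (p : ℝ) :
    chartField I (grad I fun y ↦ ‖grad I u y‖ ^ p) x =ᶠ[𝓝[range I] (extChartAt I x x)]
      localGrad (chartMetric I x) (range I)
        fun z ↦ formNorm (chartMetric I x z) (chartGrad I u x z) ^ p := by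
  have : IsManifold I 1 M := .of_le (n := 3) (by norm_num)
  filter_upwards [eventually_isSelfAdjointFieldAt_chartGrad I hu hgrad,
    eventually_eventually_nhdsWithin.2 (norm_grad_eventuallyEq I hu)] with z ⟨hz, hX⟩ hnorm
  have hz_range : z ∈ range I := extChartAt_target_subset_range x hz
  exact chartField_grad I hz (hnorm.mono fun y hy ↦ congrArg (· ^ p) hy)
    ((isMetricAt_chartMetric I hz).hasFDerivWithinAt_formNorm_rpow (I.uniqueDiffOn z hz_range)
      hz_range hX p).differentiableWithinAt

theorem pLaplacian_comp_extChartAt_symm_eventuallyEq (hu : ContMDiffAt I 𝓘(ℝ, ℝ) 2 u x)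
    (hgrad : grad I u x ≠ 0) (p : ℝ) :
    pLaplacian I p u ∘ (extChartAt I x).symm =ᶠ[𝓝[range I] (extChartAt I x x)]
      localPLaplacian (chartMetric I x) (range I) p (u ∘ (extChartAt I x).symm) := by
  have : IsManifold I 1 M := .of_le (n := 3) (by norm_num)
  have hfield : chartField I (fun y ↦ ‖grad I u y‖ ^ (p - 2) • grad I u y) x
      =ᶠ[𝓝[range I] (extChartAt I x x)] fun z ↦
        formNorm (chartMetric I x z) (chartGrad I u x z) ^ (p - 2) • chartGrad I u x z := by
    filter_upwards [norm_grad_eventuallyEq I hu, chartField_grad_eventuallyEq I hu] with z hn hX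
    rw [chartField_smul, hn, hX]
  filter_upwards [eventually_isSelfAdjointFieldAt_chartGrad I hu hgrad,
    eventually_eventually_nhdsWithin.2 hfield] with z ⟨hz, hX⟩ hfield_z
  have hz_range : z ∈ range I := extChartAt_target_subset_range x hz
  have hdiff : DifferentiableWithinAt ℝ
      (chartField I (fun y ↦ ‖grad I u y‖ ^ (p - 2) • grad I u y) x) (range I) z :=
    (((isMetricAt_chartMetric I hz).hasFDerivWithinAt_formNorm_rpow (I.uniqueDiffOn z hz_range)
      hz_range hX (p - 2)).differentiableWithinAt.smul
        hX.differentiableWithinAt).congr_of_eventuallyEq hfield_z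
          (hfield_z.self_of_nhdsWithin hz_range)
  have hright : extChartAt I x ((extChartAt I x).symm z) = z := (extChartAt I x).right_inv hz
  rw [Function.comp_apply, pLaplacian, divergence_eq_traceL_of_mem_source I
    ((extChartAt I x).map_target hz) (by rwa [hright]), hright, connDeriv_congr hz_range hfield_z]
  rfl

theorem inner_grad_pLaplacian_grad (hu : ContMDiffAt I 𝓘(ℝ, ℝ) 2 u x)
    (hgrad : grad I u x ≠ 0) (hu₃ : ThriceDifferentiableAt I u x) (p : ℝ) :
    inner ℝ (grad I (pLaplacian I p u) x) (grad I u x) =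
      fderivWithin ℝ
        (localPLaplacian (chartMetric I x) (range I) p (u ∘ (extChartAt I x).symm))
        (range I) (extChartAt I x x) (chartGrad I u x (extChartAt I x x)) := by
  have : IsManifold I 1 M := .of_le (n := 3) (by norm_num)
  rw [chartGrad_self I hu, ← tangentInner_grad_of_eventuallyEq I
    (pLaplacian_comp_extChartAt_symm_eventuallyEq I hu hgrad p)
    ((isMetricAt_chartMetric I (mem_extChartAt_target x)).differentiableWithinAt_localPLaplacian
      I.convex_range I.nonempty_interior (mem_range_self _) (contMDiffAt_iff.1 hu).2 hu₃
      (chartMetric_chartGrad_pos I hu hgrad) p)]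
  rfl

theorem ricci_grad_eq_traceL (hu : ContMDiffAt I 𝓘(ℝ, ℝ) 2 u x) :
    ricci I x (grad I u x) (grad I u x) = traceL E
      (connCurvature (leviCivita (chartMetric I x) (range I)) (range I) (extChartAt I x x)
        (chartGrad I u x (extChartAt I x x)) (chartGrad I u x (extChartAt I x x))) := by
  have : IsManifold I 1 M := .of_le (n := 3) (by norm_num)
  rw [chartGrad_self I hu]
  exact ricci_eq_traceL I x _ _

theorem pLaplacian_eq_localPLaplacian (hu : ContMDiffAt I 𝓘(ℝ, ℝ) 2 u x)
    (hgrad : grad I u x ≠ 0) (p : ℝ) :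
    pLaplacian I p u x = localPLaplacian (chartMetric I x) (range I) p
      (u ∘ (extChartAt I x).symm) (extChartAt I x x) := by
  rw [← (pLaplacian_comp_extChartAt_symm_eventuallyEq I hu hgrad p).self_of_nhdsWithin
    (mem_range_self _), Function.comp_apply, extChartAt_to_inv]

end Bochner

end PBochner

end

open PBochner in
theorem mainTheorem8_general
    {E : Type*} [NormedAddCommGroup E] [NormedSpace ℝ E] [FiniteDimensional ℝ E]
    {H : Type*} [TopologicalSpace H] (I : ModelWithCorners ℝ E H)
    {M : Type*} [TopologicalSpace M] [ChartedSpace H M] [IsManifold I 3 M]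
    [RiemannianBundle (fun x : M ↦ TangentSpace I x)]
    [IsContMDiffRiemannianBundle I 2 E (fun x : M ↦ TangentSpace I x)]
    {p : ℝ} (hp : p ≠ 0) {u : M → ℝ} {x : M} (hu : ContMDiffAt I 𝓘(ℝ, ℝ) 2 u x)
    (hgrad : grad I u x ≠ 0) (hu₃ : ThriceDifferentiableAt I u x) :
    PBochnerIdentityAt I p u x := by
  have : IsManifold I 1 M := .of_le (n := 3) (by norm_num)
  have hX := chartField_grad_eventuallyEq I hu
  have hX_selfAdjoint :=
    ((eventually_isSelfAdjointFieldAt_chartGrad I hu hgrad).self_of_nhdsWithin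
      (mem_range_self _)).2
  have hV := chartField_grad_norm_grad_rpow_eventuallyEq I hu hgrad p
  rw [PBochnerIdentityAt, linPLaplacianII_eq_traceL I hX hV, norm_grad_eq_formNorm I hX,
    inner_grad_pLaplacian_grad I hu hgrad hu₃, hessA_eq_rayleigh I hX,
    hessianNormSq_eq_traceL I hX hX_selfAdjoint, ricci_grad_eq_traceL I hu,
    pLaplacian_eq_localPLaplacian I hu hgrad]
  exact (isMetricAt_chartMetric I (mem_extChartAt_target x)).pBochner_localGrad
    I.convex_range I.nonempty_interior (mem_range_self _) (contMDiffAt_iff.1 hu).2 hu₃ rfl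
    hX_selfAdjoint.pos hp rfl

open PBochner in
theorem mainTheorem8
    {E : Type*} [NormedAddCommGroup E] [NormedSpace ℝ E] [FiniteDimensional ℝ E]
    {H : Type*} [TopologicalSpace H] (I : ModelWithCorners ℝ E H)
    {M : Type*} [TopologicalSpace M] [ChartedSpace H M] [IsManifold I ∞ M]
    [RiemannianBundle (fun x : M ↦ TangentSpace I x)]
    [IsContMDiffRiemannianBundle I ∞ E (fun x : M ↦ TangentSpace I x)]
    (p : ℝ) (hp : 1 < p) :
    (∀ (U : Set M) (u : M → ℝ), IsOpen U → ContMDiffOn I 𝓘(ℝ, ℝ) 2 u U →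
      (∀ y ∈ U, grad I u y ≠ 0) →
      ∀ x ∈ U, ThriceDifferentiableAt I u x → PBochnerIdentityAt I p u x) ∧
    (∀ (u : M → ℝ) (lam : ℝ) (x : M), ContMDiffAt I 𝓘(ℝ, ℝ) 2 u x →
      (∀ᶠ y in 𝓝 x, pLaplacian I p u y = -lam * (|u y| ^ (p - 2) * u y)) →
      grad I u x ≠ 0 → ThriceDifferentiableAt I u x → PBochnerIdentityAt I p u x) := by
  have hp₀ : p ≠ 0 := (zero_lt_one.trans hp).ne'
  exact ⟨fun U u hU hu hgrad x hx ↦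
      mainTheorem8_general I hp₀ (hu.contMDiffAt (hU.mem_nhds hx)) (hgrad x hx),
    fun u _ x hu _ ↦ mainTheorem8_general I hp₀ hu⟩
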